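/- Let $n\in\mathbb N$, $1<p<\infty$ and $t>0$. For $s>0$ let $d\mu_s(z)=(\pi s)^{-n}e^{-|z|^2/s}\,dV(z)$ on $\mathbb C^n$, where $V$ is Lebesgue measure, and let $F^p_t=L^p(\mathbb C^n,\mu_{2t/p})\cap\mathrm{Hol}(\mathbb C^n)$ be the $p$-Fock space with the norm of $L^p(\mathbb C^n,\mu_{2t/p})$. For a bounded continuous function $f$ on $\mathbb C^n$ let $T^t_f$ be the Toeplitz operator on $F^p_t$, $$ (T^t_f g)(z)=\int_{\mathbb C^n} e^{z\cdot\overline w/t} f(w)g(w)\,d\mu_t(w). $$ Let $\mathrm{BUC}(\mathbb C^n)$ be the $C^*$-algebra of bounded uniformly continuous functions $\mathbb C^n\to\mathbb C$ with pointwise operations, complex conjugation and the supremum norm. Let $\mathcal D_0\subseteq\mathrm{BUC}(\mathbb C^n)$ be a (not necessarily unital) $C^*$-subalgebra, that is, a norm-closed subalgebra closed under complex conjugation, which is $\alpha$-invariant: $\alpha_z f:=f(\cdot-z)\in\mathcal D_0$ for all $f\in\mathcal D_0$ and $z\in\mathbb C^n$. Let $\mathcal T^{p,t}_{lin}(\mathcal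 D_0)$ be the closed linear span, in the operator norm of $\mathcal L(F^p_t)$, of $\{T^t_f : f\in\mathcal D_0\}$. If $\mathcal T^{p,t}_{lin}(\mathcal D_0)$ contains a nonzero compact operator, then it contains every compact operator on $F^p_t$. -/

import Mathlib

open MeasureTheory
open scoped BoundedContinuousFunction ComplexConjugate

noncomputable section

/-- An exponent `1 < p < ∞`, seen as an exponent of an `Lᵖ` space. -/
instance fact_one_le_ofReal (p : ℝ) [hp : Fact (1 < p)] : Fact (1 ≤ ENNReal.ofReal p) :=
  ⟨ENNReal.one_le_ofReal.mpr hp.out.le⟩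

/-- The Gaussian measure `μ_t` on `ℂⁿ`, with density `(π t)⁻ⁿ exp (-|z|² / t)` with respect to
Lebesgue measure. Here `|z|² = ∑ i, ‖z i‖ ^ 2` is the Euclidean norm squared. -/
def gaussianMeasure (n : ℕ) (t : ℝ) : Measure (Fin n → ℂ) :=
  (volume : Measure (Fin n → ℂ)).withDensity fun z =>
    ENNReal.ofReal (((Real.pi * t) ^ n)⁻¹ * Real.exp (-(∑ i, ‖z i‖ ^ 2) / t))

/-- The Fock space `F^p_t = L^p(ℂⁿ, μ_{2t/p}) ∩ Hol(ℂⁿ)`, with the norm of `L^p(ℂⁿ, μ_{2t/p})`: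
the classes in `L^p` that have an entire representative. -/
def fockSpace (n : ℕ) (p t : ℝ) :
    Submodule ℂ (Lp ℂ (ENNReal.ofReal p) (gaussianMeasure n (2 * t / p))) where
  carrier := {g | ∃ h : (Fin n → ℂ) → ℂ,
    Differentiable ℂ h ∧ g =ᵐ[gaussianMeasure n (2 * t / p)] h}
  zero_mem' := ⟨fun _ => 0, differentiable_const 0, Lp.coeFn_zero _ _ _⟩
  add_mem' := by
    rintro g₁ g₂ ⟨h₁, hd₁, he₁⟩ ⟨h₂, hd₂, he₂⟩
    exact ⟨h₁ + h₂, hd₁.add hd₂, (Lp.coeFn_add g₁ g₂).trans (he₁.add he₂)⟩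
  smul_mem' := by
    rintro c g ⟨h, hd, he⟩
    exact ⟨c • h, hd.const_smul c, (Lp.coeFn_smul c g).trans (he.const_smul c)⟩

/-- The projection `(P_t h)(z) = ∫ exp (z · w̄ / t) h(w) dμ_t(w)`. -/
def fockProjection (n : ℕ) (t : ℝ) (h : (Fin n → ℂ) → ℂ) (z : Fin n → ℂ) : ℂ :=
  ∫ w, Complex.exp ((∑ i, z i * conj (w i)) / (t : ℂ)) * h w ∂(gaussianMeasure n t)

/-- The bounded operator `A` on `F^p_t` is the Toeplitz operator `T^t_f : g ↦ P_t (f g)`. -/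
def IsToeplitzOperator (n : ℕ) (p t : ℝ) [Fact (1 < p)] (f : (Fin n → ℂ) →ᵇ ℂ)
    (A : fockSpace n p t →L[ℂ] fockSpace n p t) : Prop :=
  ∀ g : fockSpace n p t,
    ((A g : Lp ℂ (ENNReal.ofReal p) (gaussianMeasure n (2 * t / p))) : (Fin n → ℂ) → ℂ)
      =ᵐ[gaussianMeasure n (2 * t / p)]
    fockProjection n t fun w =>
      f w * (g : Lp ℂ (ENNReal.ofReal p) (gaussianMeasure n (2 * t / p))) w

/-- `𝒯^{p,t}_lin(S)`: the closed linear span, in operator norm, of the Toeplitz operators on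
`F^p_t` with symbols in `S`. -/
def toeplitzLin (n : ℕ) (p t : ℝ) [Fact (1 < p)] (S : Set ((Fin n → ℂ) →ᵇ ℂ)) :
    Submodule ℂ (fockSpace n p t →L[ℂ] fockSpace n p t) :=
  (Submodule.span ℂ {A | ∃ f ∈ S, IsToeplitzOperator n p t f A}).topologicalClosure

/-- The translation `(α_z f)(w) = f (w - z)`. -/
def translateBy {n : ℕ} (z : Fin n → ℂ) (f : (Fin n → ℂ) →ᵇ ℂ) : (Fin n → ℂ) →ᵇ ℂ :=
  f.compContinuous ⟨fun w => w - z, continuous_id.sub continuous_const⟩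

end

/-! Write `K_w(z) = exp(z·w̄/t)`, let `δ_w` be evaluation at `w`, and let `δ ⊗ g` be the rank-one
operator `h ↦ δ(h) g`. The argument goes from operators to functions and back through the Berezin
transform `A ↦ (w ↦ exp(-|w|²/t) δ_w(A K_w))`.

On a Toeplitz operator this transform is the Gaussian average of the translates of the symbol, so it
maps the Toeplitz space of the closed invariant algebra `D₀` into `D₀`
(`berezin_mem_of_mem_toeplitzLin`). It maps compact operators to functions vanishing at infinity,
because the normalised evaluations are bounded and tend pointwise to zero (`tendsto_berezin`). It is
injective, because `δ_b(A K_a)` is holomorphic in `b` and antiholomorphic in `a`, hence determined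
by its diagonal (`polarization`, `eq_zero_of_berezin_eq_zero`). A nonzero compact operator in the
Toeplitz space therefore yields a nonzero function in `D₀` vanishing at infinity. Such a function
has no period, so its translates separate the points of the one-point compactification, and
Stone–Weierstrass puts every compactly supported continuous function in `D₀`
(`mem_of_hasCompactSupport`).

It remains to see that the Toeplitz operators with compactly supported symbols generate all compact
operators (`compact_mem_of_toeplitz_mem`). By Hahn–Banach, take a functional `Φ` vanishing on all of
them. Since `T_f = ∫ f(w) δ_w ⊗ K_w dμ_t(w)` converges in operator norm, `Φ` kills each `δ_w ⊗ K_w`,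
and by polarisation each `δ_b ⊗ K_a`. For cut-offs `χ_m` increasing to `1`, `φ ∘ T_{χ_m} → φ` in
norm for every functional `φ`, and `T_{χ_m} A → A` in norm for compact `A`. The first limit shows
that `Φ` kills every `φ ⊗ K_a`, the second that `Φ A = 0`. The first limit rests on a gliding-hump
argument in `L^p` with `p > 1` (`tendsto_norm_comp_mulLp_zero`), which replaces the description of
the dual space.

The analytic input is that, after multiplication by `exp(-|z|²/(2t))`, the projection `P_t` is
dominated by convolution with a Gaussian. -/

noncomputable section

/-! ### Gaussian integrals on `ℂⁿ` -/

section Gaussian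

variable {n : ℕ}

/-- The squared Euclidean norm `|z|²` on `ℂⁿ`. -/
def euclSq (z : Fin n → ℂ) : ℝ := ∑ i, ‖z i‖ ^ 2

/-- The Hermitian product `z · w̄` on `ℂⁿ`. -/
def hermProd (z w : Fin n → ℂ) : ℂ := ∑ i, z i * conj (w i)

/-- The weight `exp (-|z|² / (2t))`. -/
def fockWeight (t : ℝ) (z : Fin n → ℂ) : ℝ := Real.exp (-euclSq z / (2 * t))

/-- The sum of the moduli of the coordinates. -/
def sumNorm (z : Fin n → ℂ) : ℝ := ∑ i, ‖z i‖

lemma euclSq_nonneg (z : Fin n → ℂ) : 0 ≤ euclSq z := Finset.sum_nonneg fun _ _ => by positivity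

lemma sumNorm_nonneg (z : Fin n → ℂ) : 0 ≤ sumNorm z := Finset.sum_nonneg fun _ _ => norm_nonneg _

lemma continuous_euclSq : Continuous (euclSq : (Fin n → ℂ) → ℝ) := by
  unfold euclSq; fun_prop

lemma continuous_sumNorm : Continuous (sumNorm : (Fin n → ℂ) → ℝ) := by
  unfold sumNorm; fun_prop

lemma continuous_fockWeight (t : ℝ) : Continuous (fockWeight t : (Fin n → ℂ) → ℝ) := by
  unfold fockWeight
  exact Real.continuous_exp.comp ((continuous_euclSq.neg).div_const _)

lemma continuous_hermProd : Continuous fun x : (Fin n → ℂ) × (Fin n → ℂ) => hermProd x.1 x.2 := by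
  unfold hermProd
  have h : Continuous fun z : ℂ => conj z := Complex.continuous_conj
  fun_prop

lemma fockWeight_pos (t : ℝ) (z : Fin n → ℂ) : 0 < fockWeight t z := Real.exp_pos _

lemma fockWeight_mul_self (t : ℝ) (z : Fin n → ℂ) :
    fockWeight t z * fockWeight t z = Real.exp (-euclSq z / t) := by
  rw [fockWeight, ← Real.exp_add]
  congr 1
  by_cases ht : t = 0
  · simp [ht]
  · field_simp; ring

lemma euclSq_sub (z w : Fin n → ℂ) :
    euclSq (z - w) = euclSq z + euclSq w - 2 * (hermProd z w).re := by
  simp only [euclSq, hermProd, Complex.re_sum, Finset.mul_sum, ← Finset.sum_add_distrib,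
    ← Finset.sum_sub_distrib]
  refine Finset.sum_congr rfl fun i _ => ?_
  simp only [Pi.sub_apply, ← Complex.normSq_eq_norm_sq, Complex.normSq_sub]

lemma hermProd_self (z : Fin n → ℂ) : hermProd z z = (euclSq z : ℂ) := by
  simp only [hermProd, euclSq, Complex.ofReal_sum, Complex.mul_conj, Complex.normSq_eq_norm_sq]

lemma hermProd_add_right (z w w' : Fin n → ℂ) :
    hermProd z (w + w') = hermProd z w + hermProd z w' := by
  simp [hermProd, mul_add, Finset.sum_add_distrib]

lemma conj_hermProd (z w : Fin n → ℂ) : conj (hermProd z w) = hermProd w z := by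
  simp [hermProd, mul_comm]

/-- The norm on `Fin n → ℂ` is the sup norm, so its dual `ℓ¹` norm `sumNorm` is the natural gauge
for the growth of the kernel. -/
lemma norm_hermProd_le (z w : Fin n → ℂ) : ‖hermProd z w‖ ≤ ‖z‖ * sumNorm w := by
  unfold hermProd sumNorm
  refine (norm_sum_le _ _).trans ?_
  rw [Finset.mul_sum]
  refine Finset.sum_le_sum fun i _ => ?_
  rw [norm_mul, RCLike.norm_conj]
  exact mul_le_mul_of_nonneg_right (norm_le_pi_norm z i) (norm_nonneg _)

lemma norm_exp_hermProd (t : ℝ) (z w : Fin n → ℂ) :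
    ‖Complex.exp (hermProd z w / (t : ℂ))‖ = Real.exp ((hermProd z w).re / t) := by
  rw [Complex.norm_exp, Complex.div_ofReal_re]

/-- The weighted reproducing kernel is a Gaussian in `z - w`. -/
lemma norm_exp_hermProd_mul_fockWeight (t : ℝ) (z w : Fin n → ℂ) :
    ‖Complex.exp (hermProd z w / (t : ℂ))‖ * fockWeight t z * fockWeight t w
      = fockWeight t (z - w) := by
  rw [norm_exp_hermProd, fockWeight, fockWeight, fockWeight, ← Real.exp_add, ← Real.exp_add,
    euclSq_sub]
  congr 1
  by_cases ht : t = 0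
  · simp [ht]
  · field_simp; ring

lemma exp_neg_mul_euclSq (b : ℝ) (z : Fin n → ℂ) :
    Real.exp (-b * euclSq z) = ∏ i, Real.exp (-b * ‖z i‖ ^ 2) := by
  rw [← Real.exp_sum, euclSq, Finset.mul_sum]

lemma integral_exp_neg_mul_norm_sq_complex {b : ℝ} (hb : 0 < b) :
    ∫ z : ℂ, Real.exp (-b * ‖z‖ ^ 2) = Real.pi / b := by
  rw [GaussianFourier.integral_rexp_neg_mul_sq_norm hb, Complex.finrank_real_complex]
  norm_num

lemma integral_exp_neg_mul_euclSq {b : ℝ} (hb : 0 < b) :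
    ∫ z : Fin n → ℂ, Real.exp (-b * euclSq z) = (Real.pi / b) ^ n := by
  simp only [exp_neg_mul_euclSq]
  rw [integral_fintype_prod_volume_eq_pow (fun z : ℂ => Real.exp (-b * ‖z‖ ^ 2)),
    integral_exp_neg_mul_norm_sq_complex hb, Fintype.card_fin]

lemma integrable_exp_neg_mul_euclSq {b : ℝ} (hb : 0 < b) :
    Integrable fun z : Fin n → ℂ => Real.exp (-b * euclSq z) := by
  -- The integral of a non-integrable function is `0` by convention, so a nonzero value already
  -- proves integrability.
  refine Integrable.of_integral_ne_zero ?_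
  rw [integral_exp_neg_mul_euclSq hb]
  have := Real.pi_pos
  positivity

lemma gaussianMeasure_eq (n : ℕ) (s : ℝ) :
    gaussianMeasure n s = (volume : Measure (Fin n → ℂ)).withDensity fun z =>
      ENNReal.ofReal (((Real.pi * s) ^ n)⁻¹ * Real.exp (-euclSq z / s)) := rfl

lemma measurable_gaussianDensity (s : ℝ) : Measurable fun z : Fin n → ℂ =>
    ENNReal.ofReal (((Real.pi * s) ^ n)⁻¹ * Real.exp (-euclSq z / s)) :=
  (((Real.continuous_exp.comp ((continuous_euclSq.neg).div_const s)).measurable).const_mul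
    _).ennreal_ofReal

lemma gaussianDensity_pos {s : ℝ} (hs : 0 < s) (z : Fin n → ℂ) :
    0 < ((Real.pi * s) ^ n)⁻¹ * Real.exp (-euclSq z / s) := by
  have := Real.pi_pos
  positivity

lemma integral_gaussianMeasure {s : ℝ} (hs : 0 < s) (f : (Fin n → ℂ) → ℂ) :
    ∫ z, f z ∂(gaussianMeasure n s)
      = ((((Real.pi * s) ^ n)⁻¹ : ℝ) : ℂ) * ∫ z, (Real.exp (-euclSq z / s) : ℂ) * f z := by
  rw [gaussianMeasure_eq, integral_withDensity_eq_integral_toReal_smul (measurable_gaussianDensity s)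
    (Filter.Eventually.of_forall fun _ => ENNReal.ofReal_lt_top), ← integral_const_mul]
  refine integral_congr_ae (Filter.Eventually.of_forall fun z => ?_)
  simp only [ENNReal.toReal_ofReal (gaussianDensity_pos hs z).le, Complex.real_smul]
  push_cast
  ring

lemma integrable_gaussianMeasure_iff {s : ℝ} (hs : 0 < s) (f : (Fin n → ℂ) → ℂ) :
    Integrable f (gaussianMeasure n s)
      ↔ Integrable fun z => (Real.exp (-euclSq z / s) : ℂ) * f z := by
  rw [gaussianMeasure_eq, integrable_withDensity_iff_integrable_smul' (measurable_gaussianDensity s)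
    (Filter.Eventually.of_forall fun _ => ENNReal.ofReal_lt_top)]
  have hc : ((((Real.pi * s) ^ n)⁻¹ : ℝ) : ℂ) ≠ 0 := by
    have := Real.pi_pos
    exact Complex.ofReal_ne_zero.mpr (by positivity)
  rw [← integrable_const_mul_iff (IsUnit.mk0 _ hc)
    (fun z => (Real.exp (-euclSq z / s) : ℂ) * f z)]
  refine integrable_congr (Filter.Eventually.of_forall fun z => ?_)
  simp only [ENNReal.toReal_ofReal (gaussianDensity_pos hs z).le, Complex.real_smul]
  push_cast
  ring

lemma isProbabilityMeasure_gaussianMeasure {s : ℝ} (hs : 0 < s) :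
    IsProbabilityMeasure (gaussianMeasure n s) := by
  constructor
  rw [gaussianMeasure_eq, withDensity_apply _ MeasurableSet.univ, setLIntegral_univ]
  have h1 : ∀ z : Fin n → ℂ, Real.exp (-euclSq z / s) = Real.exp (-s⁻¹ * euclSq z) := fun z => by
    congr 1; field_simp
  simp only [h1]
  rw [← ofReal_integral_eq_lintegral_ofReal
    ((integrable_exp_neg_mul_euclSq (inv_pos.mpr hs)).const_mul _)
    (Filter.Eventually.of_forall fun z => by have := Real.pi_pos; positivity),
    integral_const_mul, integral_exp_neg_mul_euclSq (inv_pos.mpr hs), div_inv_eq_mul,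
    inv_mul_cancel₀ (by have := Real.pi_pos; positivity), ENNReal.ofReal_one]

lemma gaussianMeasure_absolutelyContinuous (n : ℕ) (s : ℝ) :
    gaussianMeasure n s ≪ (volume : Measure (Fin n → ℂ)) :=
  withDensity_absolutelyContinuous _ _

lemma absolutelyContinuous_gaussianMeasure {s : ℝ} (hs : 0 < s) :
    (volume : Measure (Fin n → ℂ)) ≪ gaussianMeasure n s :=
  withDensity_absolutelyContinuous' (measurable_gaussianDensity s).aemeasurable
    (Filter.Eventually.of_forall fun z => (ENNReal.ofReal_pos.mpr (gaussianDensity_pos hs z)).ne')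

lemma ae_gaussianMeasure_iff {s : ℝ} (hs : 0 < s) {q : (Fin n → ℂ) → Prop} :
    (∀ᵐ z ∂(gaussianMeasure n s), q z) ↔ ∀ᵐ z, q z :=
  ⟨fun h => (absolutelyContinuous_gaussianMeasure hs).ae_le h,
    fun h => (gaussianMeasure_absolutelyContinuous n s).ae_le h⟩

end Gaussian

/-! ### The weighted `Lᵖ` spaces -/

section Weighted

variable {n : ℕ} {p t : ℝ}

/-- The normalising factor comparing `L^p(μ_{2t/p})` with weighted Lebesgue measure. -/
def fockConst (n : ℕ) (p t : ℝ) : ENNReal :=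
  ENNReal.ofReal ((((Real.pi * (2 * t / p)) ^ n)⁻¹) ^ (1 / p))

lemma fockConst_ne_zero (hp : 1 < p) (ht : 0 < t) : fockConst n p t ≠ 0 := by
  have := Real.pi_pos
  exact (ENNReal.ofReal_pos.mpr (by positivity)).ne'

lemma fockConst_ne_top : fockConst n p t ≠ ⊤ := ENNReal.ofReal_ne_top

lemma ofReal_ne_zero_of_one_lt (hp : 1 < p) : ENNReal.ofReal p ≠ 0 :=
  (ENNReal.ofReal_pos.mpr (zero_lt_one.trans hp)).ne'

/-- The parameter `2t/p` is chosen so that the `p`-th root of the density is, up to a constant, the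
weight `exp(-|z|²/(2t))`, which does not depend on `p`. -/
lemma eLpNorm_gaussianMeasure (hp : 1 < p) (ht : 0 < t) (f : (Fin n → ℂ) → ℂ) :
    eLpNorm f (ENNReal.ofReal p) (gaussianMeasure n (2 * t / p))
      = fockConst n p t
        * eLpNorm (fun z => (fockWeight t z : ℂ) * f z) (ENNReal.ofReal p) volume := by
  have hp0 : 0 < p := zero_lt_one.trans hp
  have hpi := Real.pi_pos
  rw [eLpNorm_eq_lintegral_rpow_enorm_toReal (ofReal_ne_zero_of_one_lt hp) ENNReal.ofReal_ne_top,
    eLpNorm_eq_lintegral_rpow_enorm_toReal (ofReal_ne_zero_of_one_lt hp) ENNReal.ofReal_ne_top,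
    ENNReal.toReal_ofReal hp0.le, gaussianMeasure_eq,
    lintegral_withDensity_eq_lintegral_mul_non_measurable _ (measurable_gaussianDensity _)
    (Filter.Eventually.of_forall fun _ => ENNReal.ofReal_lt_top)]
  have h1 : ∀ z : Fin n → ℂ, ((fun z : Fin n → ℂ => ENNReal.ofReal
      (((Real.pi * (2 * t / p)) ^ n)⁻¹ * Real.exp (-euclSq z / (2 * t / p)))) *
        fun z : Fin n → ℂ => ‖f z‖ₑ ^ p) z
      = ENNReal.ofReal ((Real.pi * (2 * t / p)) ^ n)⁻¹
        * ‖(fockWeight t z : ℂ) * f z‖ₑ ^ p := by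
    intro z
    rw [Pi.mul_apply, ENNReal.ofReal_mul (by positivity), mul_assoc, enorm_mul,
      ENNReal.mul_rpow_of_nonneg _ _ hp0.le]
    congr 2
    rw [← ofReal_norm, Complex.norm_real, Real.norm_of_nonneg (fockWeight_pos t z).le,
      ENNReal.ofReal_rpow_of_pos (fockWeight_pos t z), fockWeight, ← Real.exp_mul]
    congr 2
    field_simp
  simp only [h1]
  rw [lintegral_const_mul' _ _ ENNReal.ofReal_ne_top, ENNReal.mul_rpow_of_nonneg _ _ (by positivity),
    fockConst, ENNReal.ofReal_rpow_of_pos (by positivity)]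

lemma memLp_gaussianMeasure_iff (hp : 1 < p) (ht : 0 < t) {f : (Fin n → ℂ) → ℂ} :
    MemLp f (ENNReal.ofReal p) (gaussianMeasure n (2 * t / p))
      ↔ MemLp (fun z => (fockWeight t z : ℂ) * f z) (ENNReal.ofReal p) volume := by
  have hs : 0 < 2 * t / p := by positivity
  have hw : AEStronglyMeasurable (fun z : Fin n → ℂ => (fockWeight t z : ℂ)) volume :=
    (Complex.continuous_ofReal.comp (continuous_fockWeight t)).aestronglyMeasurable
  have hw' : AEStronglyMeasurable (fun z : Fin n → ℂ => ((fockWeight t z : ℂ))⁻¹) volume :=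
    ((Complex.continuous_ofReal.comp (continuous_fockWeight t)).inv₀ fun z =>
      Complex.ofReal_ne_zero.mpr (fockWeight_pos t z).ne').aestronglyMeasurable
  have hne : ∀ z : Fin n → ℂ, (fockWeight t z : ℂ) ≠ 0 := fun z =>
    Complex.ofReal_ne_zero.mpr (fockWeight_pos t z).ne'
  refine ⟨fun h => ⟨?_, ?_⟩, fun h => ⟨?_, ?_⟩⟩
  · exact hw.mul (h.1.mono_ac (absolutelyContinuous_gaussianMeasure hs))
  · have h2 := h.2
    rw [eLpNorm_gaussianMeasure hp ht] at h2
    exact ENNReal.lt_top_of_mul_ne_top_right h2.ne (fockConst_ne_zero hp ht)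
  · refine AEStronglyMeasurable.mono_ac (gaussianMeasure_absolutelyContinuous n _) ?_
    refine (hw'.mul h.1).congr (Filter.Eventually.of_forall fun z => ?_)
    simp [hne z]
  · rw [eLpNorm_gaussianMeasure hp ht]
    exact ENNReal.mul_lt_top fockConst_ne_top.lt_top h.2

/-- Completing the square in each coordinate: half of the Gaussian exponent absorbs any linear
growth. -/
lemma mul_sumNorm_sub_le {b : ℝ} (hb : 0 < b) (M : ℝ) (w : Fin n → ℂ) :
    M * sumNorm w - b * euclSq w ≤ n * (M ^ 2 / (2 * b)) - b / 2 * euclSq w := by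
  have h : ∀ i : Fin n, M * ‖w i‖ - b * ‖w i‖ ^ 2 ≤ M ^ 2 / (2 * b) - b / 2 * ‖w i‖ ^ 2 := by
    intro i
    have h1 : M ^ 2 / (2 * b) - b / 2 * ‖w i‖ ^ 2 - (M * ‖w i‖ - b * ‖w i‖ ^ 2)
      = (M - b * ‖w i‖) ^ 2 / (2 * b) := by field_simp; ring
    have h2 : 0 ≤ (M - b * ‖w i‖) ^ 2 / (2 * b) := by positivity
    linarith
  have h3 := Finset.sum_le_sum fun i (_ : i ∈ Finset.univ) => h i
  simpa only [sumNorm, euclSq, Finset.sum_sub_distrib, ← Finset.mul_sum, Finset.sum_const,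
    Finset.card_univ, Fintype.card_fin, nsmul_eq_mul] using h3

lemma memLp_exp_neg_mul_euclSq {b r : ℝ} (hb : 0 < b) (hr : 0 < r) :
    MemLp (fun z : Fin n → ℂ => Real.exp (-b * euclSq z)) (ENNReal.ofReal r) volume := by
  rw [← integrable_norm_rpow_iff _ (ENNReal.ofReal_pos.mpr hr).ne' ENNReal.ofReal_ne_top]
  · refine (integrable_exp_neg_mul_euclSq (mul_pos hb hr)).congr
      (Filter.Eventually.of_forall fun z => ?_)
    simp only [ENNReal.toReal_ofReal hr.le, Real.norm_of_nonneg (Real.exp_pos _).le,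
      ← Real.exp_mul]
    congr 1; ring
  · exact (Real.continuous_exp.comp (continuous_euclSq.const_mul (-b))).aestronglyMeasurable

/-- Functions of order one are in every weighted `L^r` space. -/
lemma memLp_exp_mul_sumNorm_mul_fockWeight {r : ℝ} (hr : 0 < r) (ht : 0 < t) (M : ℝ) :
    MemLp (fun w : Fin n → ℂ => Real.exp (M * sumNorm w) * fockWeight t w)
      (ENNReal.ofReal r) volume := by
  have hb : 0 < (2 * t)⁻¹ := by positivity
  refine ((memLp_exp_neg_mul_euclSq (n := n) (half_pos hb) hr).const_mul
    (Real.exp (n * (M ^ 2 / (2 * (2 * t)⁻¹))))).mono ?_ (Filter.Eventually.of_forall fun w => ?_)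
  · exact ((Real.continuous_exp.comp (continuous_sumNorm.const_mul M)).mul
      (continuous_fockWeight t)).aestronglyMeasurable
  · rw [fockWeight, ← Real.exp_add, ← Real.exp_add, Real.norm_of_nonneg (Real.exp_pos _).le,
      Real.norm_of_nonneg (Real.exp_pos _).le, Real.exp_le_exp]
    have h := mul_sumNorm_sub_le hb M w
    rw [neg_div, div_eq_inv_mul]
    linarith

lemma memLp_fockWeight {r : ℝ} (hr : 0 < r) (ht : 0 < t) :
    MemLp (fun w : Fin n → ℂ => fockWeight t w) (ENNReal.ofReal r) volume := by
  simpa using memLp_exp_mul_sumNorm_mul_fockWeight (n := n) hr ht 0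

/-- Hölder's inequality in weighted form: a function in `L^p(μ_{2t/p})` is integrable against
functions of order one for `μ_t`. -/
lemma integrable_exp_mul_sumNorm_mul (hp : 1 < p) (ht : 0 < t) {h : (Fin n → ℂ) → ℂ}
    (hh : MemLp h (ENNReal.ofReal p) (gaussianMeasure n (2 * t / p))) (M : ℝ) :
    Integrable (fun w => (Real.exp (M * sumNorm w) : ℂ) * h w) (gaussianMeasure n t) := by
  rw [integrable_gaussianMeasure_iff ht]
  have h1 := (memLp_gaussianMeasure_iff hp ht).1 hh
  have hpq : (ENNReal.ofReal p).HolderConjugate (ENNReal.ofReal (Real.conjExponent p)) :=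
    (Real.HolderConjugate.conjExponent hp).ennrealOfReal
  have hq : 0 < Real.conjExponent p := (Real.HolderConjugate.conjExponent hp).symm.pos
  have h2 : MemLp (fun w : Fin n → ℂ => ((Real.exp (M * sumNorm w) * fockWeight t w : ℝ) : ℂ))
      (ENNReal.ofReal (Real.conjExponent p)) volume :=
    (memLp_exp_mul_sumNorm_mul_fockWeight (n := n) hq ht M).ofReal (K := ℂ)
  -- The density of `μ_t` is a constant times the square of `fockWeight`, so Hölder's inequality
  -- gives one weight to each factor.
  have h3 : MemLp _ 1 _ := h1.mul' h2 (hpqr := hpq.symm)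
  rw [memLp_one_iff_integrable] at h3
  refine h3.congr (Filter.Eventually.of_forall fun z => ?_)
  simp only [← fockWeight_mul_self]
  push_cast
  ring

end Weighted

/-! ### The projection on weighted `Lᵖ` -/

section Young

/-- Young's convolution inequality `L¹ * Lᵖ ⊆ Lᵖ` for nonnegative functions. -/
lemma lintegral_convolution_rpow_le {X : Type*} [MeasurableSpace X] [AddCommGroup X]
    [MeasurableAdd₂ X] [MeasurableNeg X] (μ : Measure X) [SFinite μ] [μ.IsAddLeftInvariant]
    [μ.IsNegInvariant] {p q : ℝ} (hpq : p.HolderConjugate q) {G u : X → ENNReal}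
    (hG : Measurable G) (hu : AEMeasurable u μ) :
    ∫⁻ z, (∫⁻ w, G (z - w) * u w ∂μ) ^ p ∂μ
      ≤ (∫⁻ w, G w ∂μ) ^ (p / q) * ((∫⁻ w, G w ∂μ) * ∫⁻ w, u w ^ p ∂μ) := by
  have hp := hpq.pos
  have hq := hpq.symm.pos
  have hGs : ∀ z, AEMeasurable (fun w => G (z - w)) μ := fun z =>
    (hG.comp (measurable_const.sub measurable_id)).aemeasurable
  have h1 : ∀ z, (∫⁻ w, G (z - w) * u w ∂μ) ^ p
      ≤ (∫⁻ w, G w ∂μ) ^ (p / q) * ∫⁻ w, G (z - w) * u w ^ p ∂μ := by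
    intro z
    -- Hölder for the splitting `G = G^(1/q) · G^(1/p)`, with `u` attached to the second factor;
    -- Tonelli then finishes.
    have h2 := ENNReal.lintegral_mul_le_Lp_mul_Lq μ hpq.symm
      (f := fun w => G (z - w) ^ (1 / q)) (g := fun w => G (z - w) ^ (1 / p) * u w)
      ((hGs z).pow_const _) (((hGs z).pow_const _).mul hu)
    have h3 : ∀ w, ((fun w => G (z - w) ^ (1 / q)) * fun w => G (z - w) ^ (1 / p) * u w) w
        = G (z - w) * u w := by
      intro w
      rw [Pi.mul_apply, ← mul_assoc, ← ENNReal.rpow_add_of_nonneg _ _ (by positivity) (by positivity),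
        one_div, one_div, hpq.symm.inv_add_inv_eq_one, ENNReal.rpow_one]
    have h4 : ∀ w, (G (z - w) ^ (1 / q)) ^ q = G (z - w) := fun w => by
      rw [← ENNReal.rpow_mul, one_div_mul_cancel hq.ne', ENNReal.rpow_one]
    have h5 : ∀ w, (G (z - w) ^ (1 / p) * u w) ^ p = G (z - w) * u w ^ p := fun w => by
      rw [ENNReal.mul_rpow_of_nonneg _ _ hp.le, ← ENNReal.rpow_mul, one_div_mul_cancel hp.ne',
        ENNReal.rpow_one]
    simp only [h3, h4, h5, lintegral_sub_left_eq_self G z] at h2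
    refine (ENNReal.rpow_le_rpow h2 hp.le).trans_eq ?_
    rw [ENNReal.mul_rpow_of_nonneg _ _ hp.le, ← ENNReal.rpow_mul, ← ENNReal.rpow_mul,
      one_div_mul_cancel hp.ne', ENNReal.rpow_one, one_div_mul_eq_div]
  refine (lintegral_mono h1).trans ?_
  have hm : AEMeasurable (fun x : X × X => G (x.1 - x.2) * u x.2 ^ p) (μ.prod μ) :=
    (hG.comp (measurable_fst.sub measurable_snd)).aemeasurable.mul
      ((hu.pow_const p).comp_quasiMeasurePreserving Measure.quasiMeasurePreserving_snd)
  rw [lintegral_const_mul'' _ hm.lintegral_prod_right', lintegral_lintegral_swap hm]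
  refine le_of_eq (congrArg _ ?_)
  have h6 : ∀ w, ∫⁻ z, G (z - w) * u w ^ p ∂μ = (∫⁻ w, G w ∂μ) * u w ^ p := fun w => by
    have hGw : Measurable fun z => G (z - w) := hG.comp (measurable_id.sub_const w)
    rw [lintegral_mul_const _ hGw, lintegral_sub_right_eq_self G w]
  simp only [h6]
  rw [lintegral_const_mul'' _ (hu.pow_const p)]

end Young

section Projection

variable {n : ℕ} {p t : ℝ}

/-- A function which is integrable for `μ_t` against all functions of order one. -/
def IsOrderOneIntegrable (t : ℝ) (h : (Fin n → ℂ) → ℂ) : Prop :=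
  ∀ M : ℝ, Integrable (fun w => (Real.exp (M * sumNorm w) : ℂ) * h w) (gaussianMeasure n t)

lemma IsOrderOneIntegrable.integrable {h : (Fin n → ℂ) → ℂ} (hh : IsOrderOneIntegrable t h) :
    Integrable h (gaussianMeasure n t) := by simpa using hh 0

lemma MeasureTheory.MemLp.isOrderOneIntegrable (hp : 1 < p) (ht : 0 < t) {h : (Fin n → ℂ) → ℂ}
    (hh : MemLp h (ENNReal.ofReal p) (gaussianMeasure n (2 * t / p))) :
    IsOrderOneIntegrable t h := integrable_exp_mul_sumNorm_mul hp ht hh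

lemma fockProjection_eq (t : ℝ) (h : (Fin n → ℂ) → ℂ) (z : Fin n → ℂ) :
    fockProjection n t h z
      = ∫ w, Complex.exp (hermProd z w / (t : ℂ)) * h w ∂(gaussianMeasure n t) := rfl

/-- All Gaussian measures have the null sets of Lebesgue measure, so the parameter `s` need not
match `t`. -/
lemma fockProjection_congr (ht : 0 < t) {h h' : (Fin n → ℂ) → ℂ} {s : ℝ} (hs : 0 < s)
    (hh : h =ᵐ[gaussianMeasure n s] h') : fockProjection n t h = fockProjection n t h' := by
  funext z
  refine integral_congr_ae ?_
  rw [Filter.EventuallyEq, ae_gaussianMeasure_iff hs] at hh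
  filter_upwards [(ae_gaussianMeasure_iff ht).2 hh] with w hw
  rw [hw]

lemma norm_exp_hermProd_le (ht : 0 < t) (z w : Fin n → ℂ) :
    ‖Complex.exp (hermProd z w / (t : ℂ))‖ ≤ Real.exp (‖z‖ / t * sumNorm w) := by
  rw [norm_exp_hermProd, Real.exp_le_exp, div_mul_eq_mul_div]
  exact div_le_div_of_nonneg_right (((Complex.re_le_norm _).trans (norm_hermProd_le z w))) ht.le

lemma continuous_exp_hermProd (t : ℝ) : Continuous fun x : (Fin n → ℂ) × (Fin n → ℂ) =>
    Complex.exp (hermProd x.1 x.2 / (t : ℂ)) :=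
  Complex.continuous_exp.comp (continuous_hermProd.div_const _)

lemma continuous_exp_hermProd_right (t : ℝ) (z : Fin n → ℂ) : Continuous fun w : Fin n → ℂ =>
    Complex.exp (hermProd z w / (t : ℂ)) :=
  (continuous_exp_hermProd t).comp (Continuous.prodMk_right z)

lemma continuous_exp_hermProd_left (t : ℝ) (w : Fin n → ℂ) : Continuous fun z : Fin n → ℂ =>
    Complex.exp (hermProd z w / (t : ℂ)) :=
  (continuous_exp_hermProd t).comp (Continuous.prodMk_left w)

lemma IsOrderOneIntegrable.integrable_kernel_mul (ht : 0 < t) {h : (Fin n → ℂ) → ℂ}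
    (hh : IsOrderOneIntegrable t h) (z : Fin n → ℂ) :
    Integrable (fun w => Complex.exp (hermProd z w / (t : ℂ)) * h w) (gaussianMeasure n t) := by
  refine (hh (‖z‖ / t)).mono
    ((continuous_exp_hermProd_right t z).aestronglyMeasurable.mul hh.integrable.1)
    (Filter.Eventually.of_forall fun w => ?_)
  rw [norm_mul, norm_mul, Complex.norm_real, Real.norm_of_nonneg (Real.exp_pos _).le]
  exact mul_le_mul_of_nonneg_right (norm_exp_hermProd_le ht z w) (norm_nonneg _)

/-- The linear form `z ↦ z · w̄`. -/
def hermForm (w : Fin n → ℂ) : (Fin n → ℂ) →L[ℂ] ℂ :=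
  ∑ i, conj (w i) • ContinuousLinearMap.proj i

lemma hermForm_apply (w z : Fin n → ℂ) : hermForm w z = hermProd z w := by
  simp [hermForm, hermProd, mul_comm]

lemma norm_hermForm_le (w : Fin n → ℂ) : ‖hermForm w‖ ≤ sumNorm w :=
  ContinuousLinearMap.opNorm_le_bound _ (sumNorm_nonneg w) fun z => by
    rw [hermForm_apply, mul_comm]; exact norm_hermProd_le z w

lemma continuous_hermForm : Continuous (hermForm : (Fin n → ℂ) → _) := by
  unfold hermForm
  have h : Continuous fun z : ℂ => conj z := Complex.continuous_conj
  fun_prop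

lemma hasFDerivAt_exp_hermProd (t : ℝ) (w z : Fin n → ℂ) :
    HasFDerivAt (fun z => Complex.exp (hermProd z w / (t : ℂ)))
      ((Complex.exp (hermProd z w / (t : ℂ)) * (t : ℂ)⁻¹) • hermForm w) z := by
  have h1 : HasFDerivAt (fun z => hermProd z w / (t : ℂ)) ((t : ℂ)⁻¹ • hermForm w) z := by
    have := (hermForm w).hasFDerivAt (x := z)
    simp only [div_eq_inv_mul]
    have h2 := this.const_smul ((t : ℂ)⁻¹)
    refine h2.congr_of_eventuallyEq (Filter.Eventually.of_forall fun z => ?_)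
    simp [hermForm_apply]
  have := h1.cexp
  rwa [smul_smul] at this

/-- `P_t h` is entire. -/
lemma IsOrderOneIntegrable.differentiable_fockProjection (ht : 0 < t) {h : (Fin n → ℂ) → ℂ}
    (hh : IsOrderOneIntegrable t h) : Differentiable ℂ (fockProjection n t h) := by
  intro z₀
  -- On the unit ball about `z₀` the kernel is at most `exp(M · sumNorm w)`. The exponent `M + 1` in
  -- the bound also absorbs the factor `‖hermForm w‖` that differentiation produces.
  set M : ℝ := (‖z₀‖ + 1) / t with hM
  have key := hasFDerivAt_integral_of_dominated_of_fderiv_le (𝕜 := ℂ)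
    (μ := gaussianMeasure n t) (x₀ := z₀) (s := Metric.ball z₀ 1)
    (F := fun z w => Complex.exp (hermProd z w / (t : ℂ)) * h w)
    (F' := fun z w => h w • ((Complex.exp (hermProd z w / (t : ℂ)) * (t : ℂ)⁻¹) • hermForm w))
    (bound := fun w => t⁻¹ * ‖(Real.exp ((M + 1) * sumNorm w) : ℂ) * h w‖)
    (Metric.ball_mem_nhds z₀ one_pos)
    (Filter.Eventually.of_forall fun z => (hh.integrable_kernel_mul ht z).1)
    (hh.integrable_kernel_mul ht z₀) ?_ ?_ ?_ ?_
  · exact key.differentiableAt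
  · refine hh.integrable.1.smul (Continuous.aestronglyMeasurable ?_)
    exact ((continuous_exp_hermProd_right t z₀).mul continuous_const).smul continuous_hermForm
  · refine Filter.Eventually.of_forall fun w z hz => ?_
    have hz' : ‖z‖ ≤ ‖z₀‖ + 1 := by
      rw [Metric.mem_ball, dist_eq_norm] at hz
      have := norm_le_norm_add_norm_sub' z z₀
      linarith
    have h1 : ‖Complex.exp (hermProd z w / (t : ℂ))‖ ≤ Real.exp (M * sumNorm w) := by
      refine (norm_exp_hermProd_le ht z w).trans (Real.exp_le_exp.mpr ?_)
      exact mul_le_mul_of_nonneg_right (div_le_div_of_nonneg_right hz' ht.le) (sumNorm_nonneg w)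
    have h2 : ‖hermForm w‖ ≤ Real.exp (sumNorm w) :=
      (norm_hermForm_le w).trans (by linarith [Real.add_one_le_exp (sumNorm w)])
    rw [norm_smul, norm_smul, norm_mul, norm_mul, norm_inv, Complex.norm_real, Complex.norm_real,
      Real.norm_of_nonneg ht.le, Real.norm_of_nonneg (Real.exp_pos _).le, add_mul, one_mul,
      Real.exp_add]
    calc ‖h w‖ * (‖Complex.exp (hermProd z w / (t : ℂ))‖ * t⁻¹ * ‖hermForm w‖)
        ≤ ‖h w‖ * (Real.exp (M * sumNorm w) * t⁻¹ * Real.exp (sumNorm w)) := by gcongr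
      _ = t⁻¹ * (Real.exp (M * sumNorm w) * Real.exp (sumNorm w) * ‖h w‖) := by ring
  · exact (hh (M + 1)).norm.const_mul _
  · refine Filter.Eventually.of_forall fun w z _ => ?_
    exact (hasFDerivAt_exp_hermProd t w z).mul_const (h w)

/-- The pointwise convolution bound for the weighted projection. -/
lemma enorm_fockProjection_le (ht : 0 < t) (h : (Fin n → ℂ) → ℂ) (z : Fin n → ℂ) :
    ‖(fockWeight t z : ℂ) * fockProjection n t h z‖ₑ
      ≤ ENNReal.ofReal ((Real.pi * t) ^ n)⁻¹ *
        ∫⁻ w, ENNReal.ofReal (fockWeight t (z - w)) * ‖(fockWeight t w : ℂ) * h w‖ₑ := by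
  have hc : 0 ≤ ((Real.pi * t) ^ n)⁻¹ := by have := Real.pi_pos; positivity
  rw [fockProjection_eq, integral_gaussianMeasure ht, mul_left_comm, enorm_mul,
    ← ofReal_norm, Complex.norm_real, Real.norm_of_nonneg hc]
  gcongr
  rw [← integral_const_mul]
  refine (enorm_integral_le_lintegral_enorm _).trans_eq (lintegral_congr fun w => ?_)
  rw [← norm_exp_hermProd_mul_fockWeight, ← fockWeight_mul_self, ← ofReal_norm, ← ofReal_norm,
    ← ENNReal.ofReal_mul (by have := fockWeight_pos t z; have := fockWeight_pos t w; positivity)]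
  congr 1
  simp only [norm_mul, Complex.norm_real, Real.norm_of_nonneg (fockWeight_pos t _).le,
    Complex.ofReal_mul]
  ring

lemma lintegral_ofReal_fockWeight_rpow_lt_top {r : ℝ} (hr : 0 < r) (ht : 0 < t) :
    ∫⁻ w : Fin n → ℂ, ENNReal.ofReal (fockWeight t w) ^ r < ⊤ := by
  have h := (memLp_fockWeight (n := n) hr ht).2
  rw [eLpNorm_lt_top_iff_lintegral_rpow_enorm_lt_top (ENNReal.ofReal_pos.mpr hr).ne'
    ENNReal.ofReal_ne_top, ENNReal.toReal_ofReal hr.le] at h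
  refine (lintegral_congr fun w => ?_).trans_lt h
  rw [← ofReal_norm, Real.norm_of_nonneg (fockWeight_pos t w).le]

lemma aemeasurable_ofReal_fockWeight (z : Fin n → ℂ) :
    Measurable fun w : Fin n → ℂ => ENNReal.ofReal (fockWeight t (z - w)) :=
  ((continuous_fockWeight t).comp (continuous_const.sub continuous_id)).measurable.ennreal_ofReal

/-- Boundedness of `P_t`: the weighted projection is dominated by convolution with the integrable
function `fockWeight`, so Young's inequality applies. -/
lemma exists_eLpNorm_fockProjection_le (n : ℕ) (hp : 1 < p) (ht : 0 < t) :
    ∃ C : ENNReal, C ≠ ⊤ ∧ ∀ h : (Fin n → ℂ) → ℂ,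
      MemLp h (ENNReal.ofReal p) (gaussianMeasure n (2 * t / p)) →
      eLpNorm (fockProjection n t h) (ENNReal.ofReal p) (gaussianMeasure n (2 * t / p))
        ≤ C * eLpNorm h (ENNReal.ofReal p) (gaussianMeasure n (2 * t / p)) := by
  have hpq := Real.HolderConjugate.conjExponent hp
  have hp0 := hpq.pos
  have hq := hpq.symm.pos
  set A : ENNReal := ∫⁻ w : Fin n → ℂ, ENNReal.ofReal (fockWeight t w) with hA
  have hAt : A ≠ ⊤ := by
    have := lintegral_ofReal_fockWeight_rpow_lt_top (n := n) one_pos ht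
    simp only [ENNReal.rpow_one] at this
    exact this.ne
  set c : ENNReal := ENNReal.ofReal ((Real.pi * t) ^ n)⁻¹
  refine ⟨c * (A ^ (p / Real.conjExponent p) * A) ^ (1 / p), ?_, fun h hh => ?_⟩
  · refine ENNReal.mul_ne_top ENNReal.ofReal_ne_top (ENNReal.rpow_ne_top_of_nonneg (by positivity) ?_)
    exact ENNReal.mul_ne_top (ENNReal.rpow_ne_top_of_nonneg (by positivity) hAt) hAt
  · rw [eLpNorm_gaussianMeasure hp ht, eLpNorm_gaussianMeasure hp ht, mul_left_comm]
    gcongr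
    have hm := ((memLp_gaussianMeasure_iff hp ht).1 hh).1.enorm
    rw [eLpNorm_eq_lintegral_rpow_enorm_toReal (ofReal_ne_zero_of_one_lt hp) ENNReal.ofReal_ne_top,
      eLpNorm_eq_lintegral_rpow_enorm_toReal (ofReal_ne_zero_of_one_lt hp) ENNReal.ofReal_ne_top,
      ENNReal.toReal_ofReal hp0.le]
    have h1 : ∫⁻ z, ‖(fockWeight t z : ℂ) * fockProjection n t h z‖ₑ ^ p
        ≤ c ^ p * (A ^ (p / Real.conjExponent p) *
          (A * ∫⁻ w, ‖(fockWeight t w : ℂ) * h w‖ₑ ^ p)) := by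
      refine (lintegral_mono fun z => ENNReal.rpow_le_rpow (enorm_fockProjection_le ht h z)
        hp0.le).trans ?_
      simp only [ENNReal.mul_rpow_of_nonneg _ _ hp0.le]
      rw [lintegral_const_mul' _ _ (ENNReal.rpow_ne_top_of_nonneg hp0.le ENNReal.ofReal_ne_top)]
      gcongr
      have := lintegral_convolution_rpow_le volume hpq
        (G := fun w : Fin n → ℂ => ENNReal.ofReal (fockWeight t w))
        (continuous_fockWeight t).measurable.ennreal_ofReal hm
      simpa only [ENNReal.mul_rpow_of_nonneg _ _ hp0.le] using this
    refine (ENNReal.rpow_le_rpow h1 (by positivity)).trans_eq ?_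
    rw [← mul_assoc (A ^ _), ENNReal.mul_rpow_of_nonneg _ _ (by positivity),
      ENNReal.mul_rpow_of_nonneg (A ^ _ * A) _ (by positivity), ← ENNReal.rpow_mul,
      mul_one_div_cancel hp0.ne', ENNReal.rpow_one, mul_assoc]

/-- The same convolution bound, now with Hölder in place of Young. The constant is uniform in `z`
because the `L^q` norm of `fockWeight` is translation invariant. -/
lemma exists_enorm_fockProjection_le (n : ℕ) (hp : 1 < p) (ht : 0 < t) :
    ∃ C : ENNReal, C ≠ ⊤ ∧ ∀ (h : (Fin n → ℂ) → ℂ) (z : Fin n → ℂ),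
      MemLp h (ENNReal.ofReal p) (gaussianMeasure n (2 * t / p)) →
      ‖(fockWeight t z : ℂ) * fockProjection n t h z‖ₑ
        ≤ C * eLpNorm h (ENNReal.ofReal p) (gaussianMeasure n (2 * t / p)) := by
  have hpq := Real.HolderConjugate.conjExponent hp
  have hp0 := hpq.pos
  have hq := hpq.symm.pos
  set B : ENNReal :=
    (∫⁻ w : Fin n → ℂ, ENNReal.ofReal (fockWeight t w) ^ Real.conjExponent p)
      ^ (1 / Real.conjExponent p)
  have hB : B ≠ ⊤ := ENNReal.rpow_ne_top_of_nonneg (by positivity)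
    (lintegral_ofReal_fockWeight_rpow_lt_top (n := n) hq ht).ne
  set c : ENNReal := ENNReal.ofReal ((Real.pi * t) ^ n)⁻¹
  refine ⟨c * B * (fockConst n p t)⁻¹, ENNReal.mul_ne_top (ENNReal.mul_ne_top
    ENNReal.ofReal_ne_top hB) (ENNReal.inv_ne_top.2 (fockConst_ne_zero hp ht)), fun h z hh => ?_⟩
  have hm := ((memLp_gaussianMeasure_iff hp ht).1 hh).1.enorm
  rw [eLpNorm_gaussianMeasure hp ht, mul_assoc, ← mul_assoc _⁻¹,
    ENNReal.inv_mul_cancel (fockConst_ne_zero hp ht) fockConst_ne_top, one_mul, mul_assoc]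
  refine (enorm_fockProjection_le ht h z).trans (mul_le_mul_right ?_ _)
  have h1 := ENNReal.lintegral_mul_le_Lp_mul_Lq volume hpq.symm
    (aemeasurable_ofReal_fockWeight (t := t) z).aemeasurable hm
  rw [lintegral_sub_left_eq_self
    (fun w : Fin n → ℂ => ENNReal.ofReal (fockWeight t w) ^ Real.conjExponent p) z] at h1
  rw [eLpNorm_eq_lintegral_rpow_enorm_toReal (ofReal_ne_zero_of_one_lt hp) ENNReal.ofReal_ne_top,
      ENNReal.toReal_ofReal hp0.le]
  exact h1

/-- `P_t` maps `L^p(μ_{2t/p})` to itself. -/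
lemma memLp_fockProjection (hp : 1 < p) (ht : 0 < t) {h : (Fin n → ℂ) → ℂ}
    (hh : MemLp h (ENNReal.ofReal p) (gaussianMeasure n (2 * t / p))) :
    MemLp (fockProjection n t h) (ENNReal.ofReal p) (gaussianMeasure n (2 * t / p)) := by
  obtain ⟨C, hC, hle⟩ := exists_eLpNorm_fockProjection_le n hp ht
  exact ⟨((hh.isOrderOneIntegrable hp ht).differentiable_fockProjection
    ht).continuous.aestronglyMeasurable,
    (hle h hh).trans_lt (ENNReal.mul_lt_top hC.lt_top hh.2)⟩

end Projection

/-! ### The reproducing property -/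

section Reproducing

variable {n : ℕ} {p t : ℝ}

lemma measurePreserving_unit_smul (c : Circle) :
    MeasurePreserving (fun w : Fin n → ℂ => (c : ℂ) • w) volume volume :=
  volume_preserving_pi (fun _ => (rotation c).measurePreserving)

lemma euclSq_unit_smul (c : Circle) (w : Fin n → ℂ) : euclSq ((c : ℂ) • w) = euclSq w := by
  simp [euclSq, Circle.norm_coe]

lemma measurableEmbedding_unit_smul (c : Circle) :
    MeasurableEmbedding (fun w : Fin n → ℂ => (c : ℂ) • w) :=
  (Homeomorph.smulOfNeZero (c : ℂ) c.coe_ne_zero).measurableEmbedding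

lemma measurePreserving_unit_smul_gaussianMeasure (s : ℝ) (c : Circle) :
    MeasurePreserving (fun w : Fin n → ℂ => (c : ℂ) • w)
      (gaussianMeasure n s) (gaussianMeasure n s) := by
  refine ⟨(measurePreserving_unit_smul c).measurable, Measure.ext fun S hS => ?_⟩
  rw [Measure.map_apply (measurePreserving_unit_smul c).measurable hS, gaussianMeasure_eq,
    withDensity_apply _ hS, withDensity_apply _ ((measurePreserving_unit_smul c).measurable hS),
    ← (measurePreserving_unit_smul c).setLIntegral_comp_preimage_emb
      (measurableEmbedding_unit_smul c) _ S]
  simp only [euclSq_unit_smul]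

/-- The mean value property for the Gaussian measure. -/
lemma integral_gaussianMeasure_of_differentiable {s : ℝ} (hs : 0 < s) {g : (Fin n → ℂ) → ℂ}
    (hg : Differentiable ℂ g) (hi : Integrable g (gaussianMeasure n s)) :
    ∫ w, g w ∂(gaussianMeasure n s) = g 0 := by
  have := isProbabilityMeasure_gaussianMeasure (n := n) hs
  have hrot : ∀ θ : ℝ, ∫ w, g (circleMap 0 1 θ • w) ∂(gaussianMeasure n s)
      = ∫ w, g w ∂(gaussianMeasure n s) := fun θ => by
    have := (measurePreserving_unit_smul_gaussianMeasure (n := n) s (Circle.exp θ)).integral_comp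
      (measurableEmbedding_unit_smul _) g
    simpa [circleMap] using this
  have hrotn : ∀ θ : ℝ, ∫ w, ‖g (circleMap 0 1 θ • w)‖ ∂(gaussianMeasure n s)
      = ∫ w, ‖g w‖ ∂(gaussianMeasure n s) := fun θ => by
    have := (measurePreserving_unit_smul_gaussianMeasure (n := n) s (Circle.exp θ)).integral_comp
      (measurableEmbedding_unit_smul _) (fun w => ‖g w‖)
    simpa [circleMap] using this
  have hroti : ∀ θ : ℝ, Integrable (fun w => g (circleMap 0 1 θ • w)) (gaussianMeasure n s) :=
    fun θ => by
    have := (measurePreserving_unit_smul_gaussianMeasure (n := n) s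
      (Circle.exp θ)).integrable_comp_of_integrable hi
    simpa [circleMap, Function.comp_def] using this
  have hint : Integrable (Function.uncurry fun (θ : ℝ) (w : Fin n → ℂ) => g (circleMap 0 1 θ • w))
      ((volume.restrict (Set.Ioc 0 (2 * Real.pi))).prod (gaussianMeasure n s)) := by
    have hc : Continuous (Function.uncurry fun (θ : ℝ) (w : Fin n → ℂ) =>
        g (circleMap 0 1 θ • w)) :=
      hg.continuous.comp (((continuous_circleMap 0 1).comp continuous_fst).smul continuous_snd)
    rw [integrable_prod_iff hc.aestronglyMeasurable]
    refine ⟨Filter.Eventually.of_forall hroti, ?_⟩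
    simp only [Function.uncurry_apply_pair, hrotn]
    exact integrable_const _
  -- Each slice `ζ ↦ g (ζ w)` is entire, so its average over the unit circle is `g 0`. Rotation
  -- invariance of the measure and Fubini transfer this to the Gaussian integral.
  have hmean : ∀ w : Fin n → ℂ,
      ∫ θ in Set.Ioc 0 (2 * Real.pi), g (circleMap 0 1 θ • w) = (2 * Real.pi : ℝ) • g 0 := by
    intro w
    have h1 : Differentiable ℂ fun ζ : ℂ => g (ζ • w) :=
      hg.comp (differentiable_id.smul_const w)
    have h2 := (h1.diffContOnCl (s := Metric.ball 0 |1|)).circleAverage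
    rw [Real.circleAverage_def, intervalIntegral.integral_of_le Real.two_pi_pos.le, zero_smul] at h2
    rw [← h2, smul_smul, mul_inv_cancel₀ Real.two_pi_pos.ne', one_smul]
  have hswap := integral_integral_swap hint
  simp only [hrot, hmean] at hswap
  have h3 : (2 * Real.pi : ℝ) • ∫ w, g w ∂(gaussianMeasure n s) = (2 * Real.pi : ℝ) • g 0 := by
    simpa [Real.pi_pos.le] using hswap
  exact smul_right_injective ℂ Real.two_pi_pos.ne' h3

/-- The pointwise identity by which a translation by `z` turns the reproducing formula at `z` into
the mean value property at `0`. -/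
lemma exp_euclSq_sub_mul (t : ℝ) (w z : Fin n → ℂ) :
    (Real.exp (-euclSq (w - z) / t) : ℂ) * Complex.exp (-hermProd (w - z) z / (t : ℂ))
      = (Real.exp (-euclSq w / t) : ℂ) * Complex.exp (hermProd z w / (t : ℂ)) := by
  rw [Complex.ofReal_exp, Complex.ofReal_exp, ← Complex.exp_add, ← Complex.exp_add]
  congr 1
  push_cast
  rw [← hermProd_self, ← hermProd_self, ← add_div, ← add_div]
  congr 1
  simp only [hermProd, ← Finset.sum_neg_distrib, ← Finset.sum_add_distrib, Pi.sub_apply, map_sub]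
  exact Finset.sum_congr rfl fun i _ => by ring

/-- The reproducing property `P_t g = g` of entire functions. -/
lemma IsOrderOneIntegrable.fockProjection_eq_self (ht : 0 < t) {g : (Fin n → ℂ) → ℂ}
    (hg : Differentiable ℂ g) (hi : IsOrderOneIntegrable t g) : fockProjection n t g = g := by
  funext z
  -- The translate of `g` by `z`, twisted so that its Gaussian mean is `P_t g` at `z` while its
  -- value at `0` is `g z`.
  set G : (Fin n → ℂ) → ℂ := fun w => g (w + z) * Complex.exp (-hermProd w z / (t : ℂ)) with hG
  have hpt : ∀ w : Fin n → ℂ, (Real.exp (-euclSq (w - z) / t) : ℂ) * G (w - z)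
      = (Real.exp (-euclSq w / t) : ℂ) * (Complex.exp (hermProd z w / (t : ℂ)) * g w) := by
    intro w
    simp only [hG, sub_add_cancel]
    rw [mul_left_comm, exp_euclSq_sub_mul]
    ring
  have hGd : Differentiable ℂ G := by
    refine (hg.comp (differentiable_id.add_const z)).mul ?_
    have : Differentiable ℂ fun w : Fin n → ℂ => hermProd w z := by
      simp only [← hermForm_apply]
      exact (hermForm z).differentiable
    simp only [div_eq_mul_inv]
    exact (this.neg.mul_const _).cexp
  have hGi : Integrable G (gaussianMeasure n t) := by
    rw [integrable_gaussianMeasure_iff ht]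
    have h1 := (integrable_gaussianMeasure_iff ht _).1 (hi.integrable_kernel_mul ht z)
    simp only [← hpt] at h1
    simpa using h1.comp_add_right z
  have h0 := integral_gaussianMeasure_of_differentiable ht hGd hGi
  have hG0 : G 0 = g z := by simp [hG, hermProd]
  rw [← hG0, ← h0, fockProjection_eq, integral_gaussianMeasure ht, integral_gaussianMeasure ht]
  simp only [← hpt]
  rw [integral_sub_right_eq_self (fun w => (Real.exp (-euclSq w / t) : ℂ) * G w) z]

end Reproducing

/-! ### Vector-valued holomorphic curves -/

section Curves

/-- A continuous curve in a Banach space which is holomorphic after composition with a separating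
family of functionals is holomorphic. -/
lemma differentiable_of_separating {E ι : Type*} [NormedAddCommGroup E] [NormedSpace ℂ E]
    [CompleteSpace E] {f : ℂ → E} (hf : Continuous f) (ℓ : ι → E →L[ℂ] ℂ)
    (hsep : ∀ x, (∀ i, ℓ i x = 0) → x = 0) (hd : ∀ i, Differentiable ℂ fun z => ℓ i (f z)) :
    Differentiable ℂ f := by
  intro z₀
  have hci : CircleIntegrable f z₀ (1 : NNReal) := hf.continuousOn.circleIntegrable zero_le_one
  -- The Cauchy integral of a continuous function is analytic in any case. It equals `f` because
  -- each `ℓ i` sees the scalar Cauchy formula.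
  have hps := hasFPowerSeriesOn_cauchy_integral hci one_pos
  refine (hps.differentiableOn.differentiableAt
    (Metric.eball_mem_nhds z₀ (by simp))).congr_of_eventuallyEq ?_
  filter_upwards [Metric.ball_mem_nhds z₀ one_pos] with w hw
  refine sub_eq_zero.1 (hsep _ fun i => ?_)
  have h1 := ((hd i).diffContOnCl (s := Metric.ball z₀ 1)).two_pi_i_inv_smul_circleIntegral_sub_inv_smul hw
  have hint : CircleIntegrable (fun z => (z - w)⁻¹ • f z) z₀ 1 := by
    refine ContinuousOn.circleIntegrable zero_le_one ?_
    refine (ContinuousOn.inv₀ (by fun_prop) fun z hz => ?_).smul hf.continuousOn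
    rw [sub_ne_zero]
    rintro rfl
    exact (Metric.mem_ball.1 hw).ne (Metric.mem_sphere.1 hz)
  have h2 : ℓ i (∮ z in C(z₀, 1), (z - w)⁻¹ • f z) = ∮ z in C(z₀, 1), (z - w)⁻¹ • ℓ i (f z) := by
    rw [circleIntegral, circleIntegral, ← (ℓ i).intervalIntegral_comp_comm hint.out]
    simp only [map_smul]
  rw [map_sub, map_smul, NNReal.coe_one, h2, h1, sub_self]

lemma norm_exp_sub_exp_le {a b : ℂ} {r : ℝ} (ha : ‖a‖ ≤ r) (hb : ‖b‖ ≤ r) :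
    ‖Complex.exp a - Complex.exp b‖ ≤ Real.exp r * ‖a - b‖ := by
  refine Convex.norm_image_sub_le_of_norm_deriv_le (s := Metric.closedBall 0 r)
    (fun x _ => Complex.differentiableAt_exp) (fun x hx => ?_) (convex_closedBall 0 r)
    (by simpa using hb) (by simpa using ha)
  rw [Complex.deriv_exp, Complex.norm_exp, Real.exp_le_exp]
  exact (Complex.re_le_norm x).trans (by simpa using hx)

/-- Identity theorem: the real zeros `1/(k+1)` accumulate at `0`. -/
lemma eq_zero_of_real_eq_zero {f : ℂ → ℂ} (hf : Differentiable ℂ f) (h : ∀ x : ℝ, f x = 0) (z : ℂ) :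
    f z = 0 := by
  have h1 : AnalyticOnNhd ℂ f Set.univ := fun z _ => hf.analyticAt z
  have h2 := h1.eqOn_zero_of_preconnected_of_frequently_eq_zero isPreconnected_univ
    (Set.mem_univ 0) ?_
  · exact h2 (Set.mem_univ z)
  · have h3 : Filter.Tendsto (fun k : ℕ => (((1 / ((k : ℝ) + 1) : ℝ)) : ℂ)) Filter.atTop
        (nhdsWithin 0 {0}ᶜ) := by
      refine tendsto_nhdsWithin_iff.2 ⟨?_, Filter.Eventually.of_forall fun k => ?_⟩
      · have := (Complex.continuous_ofReal.tendsto 0).comp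
          (tendsto_one_div_add_atTop_nhds_zero_nat (𝕜 := ℝ))
        simpa [Function.comp_def] using this
      · rw [Set.mem_compl_singleton_iff, Complex.ofReal_ne_zero]
        positivity
    exact h3.frequently (Filter.Frequently.of_forall fun k => h _)

lemma bilinear_eq_zero_of_real_eq_zero {E E' : Type*} [NormedAddCommGroup E] [NormedSpace ℂ E]
    [NormedAddCommGroup E'] [NormedSpace ℂ E'] (B : E →L[ℂ] E' →L[ℂ] ℂ) {f : ℂ → E} {g : ℂ → E'}
    (hf : Differentiable ℂ f) (hg : Differentiable ℂ g) (h : ∀ x : ℝ, B (f x) (g x) = 0) (z : ℂ) :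
    B (f z) (g z) = 0 := by
  have h1 : Differentiable ℂ fun ζ : ℂ => B (f ζ) := B.differentiable.comp hf
  exact eq_zero_of_real_eq_zero (h1.clm_apply hg) h z

lemma continuous_of_norm_sub_le {X E : Type*} [PseudoMetricSpace X] [SeminormedAddCommGroup E]
    {f : X → E} (h : ∀ x₀, ∃ C : ℝ, ∀ x ∈ Metric.ball x₀ 1, ‖f x - f x₀‖ ≤ C * dist x x₀) :
    Continuous f := by
  rw [continuous_iff_continuousAt]
  intro x₀
  obtain ⟨C, hC⟩ := h x₀
  rw [ContinuousAt, tendsto_iff_dist_tendsto_zero]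
  refine squeeze_zero' (Filter.Eventually.of_forall fun _ => dist_nonneg)
    (g := fun x => C * dist x x₀) ?_ ?_
  · filter_upwards [Metric.ball_mem_nhds x₀ one_pos] with x hx
    rw [dist_eq_norm]
    exact hC x hx
  · have : Continuous fun x => C * dist x x₀ := by fun_prop
    simpa using this.tendsto x₀

end Curves

/-! ### Operators on the Fock space -/

section FockOperators

variable {n : ℕ} {p t : ℝ} [hpf : Fact (1 < p)] [htf : Fact (0 < t)]

/-- The space `L^p(μ_{2t/p})`. -/
abbrev FockLp (n : ℕ) (p t : ℝ) := Lp ℂ (ENNReal.ofReal p) (gaussianMeasure n (2 * t / p))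

include hpf htf in
lemma fock_param_pos : 0 < 2 * t / p :=
  div_pos (mul_pos two_pos htf.out) (zero_lt_one.trans hpf.out)

include hpf htf in
lemma isOrderOneIntegrable_Lp (u : FockLp n p t) : IsOrderOneIntegrable t u :=
  (Lp.memLp u).isOrderOneIntegrable hpf.out htf.out

include hpf htf in
lemma memLp_fockProjection_Lp (u : FockLp n p t) :
    MemLp (fockProjection n t u) (ENNReal.ofReal p) (gaussianMeasure n (2 * t / p)) :=
  memLp_fockProjection hpf.out htf.out (Lp.memLp u)

include hpf htf in
lemma fockProjection_add (u v : FockLp n p t) (z : Fin n → ℂ) :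
    fockProjection n t (u + v : FockLp n p t) z
      = fockProjection n t u z + fockProjection n t v z := by
  rw [fockProjection_congr htf.out fock_param_pos (Lp.coeFn_add u v)]
  simp only [fockProjection_eq, Pi.add_apply, mul_add]
  exact integral_add ((isOrderOneIntegrable_Lp u).integrable_kernel_mul htf.out z)
    ((isOrderOneIntegrable_Lp v).integrable_kernel_mul htf.out z)

include hpf htf in
lemma fockProjection_smul (c : ℂ) (u : FockLp n p t) (z : Fin n → ℂ) :
    fockProjection n t (c • u : FockLp n p t) z = c * fockProjection n t u z := by
  rw [fockProjection_congr htf.out fock_param_pos (Lp.coeFn_smul c u)]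
  simp only [fockProjection_eq, Pi.smul_apply, smul_eq_mul, mul_left_comm _ c]
  exact integral_const_mul _ _

/-- Evaluation of `P_t u` at `b`, as a functional on `L^p`. -/
def evalLp (n : ℕ) (p t : ℝ) [hpf : Fact (1 < p)] [htf : Fact (0 < t)] (b : Fin n → ℂ) :
    FockLp n p t →L[ℂ] ℂ :=
  LinearMap.mkContinuousOfExistsBound
    { toFun := fun u => fockProjection n t u b
      map_add' := fun u v => fockProjection_add u v b
      map_smul' := fun c u => fockProjection_smul c u b } <| by
    obtain ⟨C, hC, hle⟩ := exists_enorm_fockProjection_le n hpf.out htf.out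
    refine ⟨C.toReal * (fockWeight t b)⁻¹, fun u => ?_⟩
    have h := ENNReal.toReal_mono (ENNReal.mul_ne_top hC (Lp.memLp u).2.ne)
      (hle u b (Lp.memLp u))
    rw [ENNReal.toReal_mul, ← Lp.norm_def, toReal_enorm, norm_mul, Complex.norm_real,
      Real.norm_of_nonneg (fockWeight_pos t b).le] at h
    rw [mul_right_comm, ← div_eq_mul_inv, le_div_iff₀ (fockWeight_pos t b), mul_comm]
    exact h

lemma evalLp_apply (b : Fin n → ℂ) (u : FockLp n p t) :
    evalLp n p t b u = fockProjection n t u b := rfl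

/-- Uniformity in `b` is the point: it makes the normalised evaluations a bounded family. -/
lemma exists_norm_evalLp_le (n : ℕ) (p t : ℝ) [hpf : Fact (1 < p)] [htf : Fact (0 < t)] :
    ∃ C : ℝ, 0 ≤ C ∧ ∀ b, ‖evalLp n p t b‖ * fockWeight t b ≤ C := by
  obtain ⟨C, hC, hle⟩ := exists_enorm_fockProjection_le n hpf.out htf.out
  refine ⟨C.toReal, ENNReal.toReal_nonneg, fun b => ?_⟩
  refine (le_div_iff₀ (fockWeight_pos t b)).1 ?_
  rw [div_eq_mul_inv C.toReal]
  refine ContinuousLinearMap.opNorm_le_bound _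
    (mul_nonneg ENNReal.toReal_nonneg (inv_nonneg.2 (fockWeight_pos t b).le)) fun u => ?_
  have h := ENNReal.toReal_mono (ENNReal.mul_ne_top hC (Lp.memLp u).2.ne)
    (hle u b (Lp.memLp u))
  rw [ENNReal.toReal_mul, ← Lp.norm_def, toReal_enorm, norm_mul, Complex.norm_real,
    Real.norm_of_nonneg (fockWeight_pos t b).le] at h
  rw [mul_right_comm, ← div_eq_mul_inv, le_div_iff₀ (fockWeight_pos t b), mul_comm]
  exact h

lemma differentiable_evalLp (u : FockLp n p t) : Differentiable ℂ fun b => evalLp n p t b u :=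
  (isOrderOneIntegrable_Lp u).differentiable_fockProjection htf.out

/-- The class of `P_t u` in `L^p`. -/
def projLp (u : FockLp n p t) : FockLp n p t := (memLp_fockProjection_Lp u).toLp _

lemma coeFn_projLp (u : FockLp n p t) :
    (projLp u : (Fin n → ℂ) → ℂ) =ᵐ[gaussianMeasure n (2 * t / p)] fockProjection n t u :=
  MemLp.coeFn_toLp (memLp_fockProjection_Lp u)

/-- The projection `P_t` of `L^p` onto the Fock space. -/
def fockProj (n : ℕ) (p t : ℝ) [hpf : Fact (1 < p)] [htf : Fact (0 < t)] :
    FockLp n p t →L[ℂ] fockSpace n p t :=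
  LinearMap.mkContinuousOfExistsBound
    { toFun := fun u => ⟨projLp u, fockProjection n t u, differentiable_evalLp u, coeFn_projLp u⟩
      map_add' := fun u v => by
        refine Subtype.ext (Lp.ext ?_)
        filter_upwards [coeFn_projLp u, coeFn_projLp v, coeFn_projLp (u + v),
          Lp.coeFn_add (projLp u) (projLp v)] with z h1 h2 h3 h4
        exact h3.trans ((fockProjection_add u v z).trans (by rw [← h1, ← h2]; exact h4.symm))
      map_smul' := fun c u => by
        refine Subtype.ext (Lp.ext ?_)
        filter_upwards [coeFn_projLp u, coeFn_projLp (c • u), Lp.coeFn_smul c (projLp u)]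
          with z h1 h2 h3
        exact h2.trans ((fockProjection_smul c u z).trans (by rw [← h1]; exact h3.symm)) } <| by
    obtain ⟨C, hC, hle⟩ := exists_eLpNorm_fockProjection_le n hpf.out htf.out
    refine ⟨C.toReal, fun u => ?_⟩
    have h := ENNReal.toReal_mono (ENNReal.mul_ne_top hC (Lp.memLp u).2.ne)
      (hle u (Lp.memLp u))
    rw [ENNReal.toReal_mul, ← Lp.norm_def, ← Lp.norm_toLp _ (memLp_fockProjection_Lp u)] at h
    exact h

lemma coeFn_fockProj (u : FockLp n p t) :
    ((fockProj n p t u : FockLp n p t) : (Fin n → ℂ) → ℂ)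
      =ᵐ[gaussianMeasure n (2 * t / p)] fockProjection n t u := coeFn_projLp u

/-- Elements of the Fock space agree with their projection. -/
lemma coeFn_fockSpace (g : fockSpace n p t) :
    ((g : FockLp n p t) : (Fin n → ℂ) → ℂ)
      =ᵐ[gaussianMeasure n (2 * t / p)] fun b => evalLp n p t b g := by
  obtain ⟨h, hd, he⟩ := g.2
  have h1 : IsOrderOneIntegrable t h :=
    ((memLp_congr_ae he).1 (Lp.memLp (g : FockLp n p t))).isOrderOneIntegrable hpf.out htf.out
  refine he.trans (Filter.Eventually.of_forall fun b => ?_)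
  simp only [evalLp_apply]
  rw [fockProjection_congr htf.out fock_param_pos he, h1.fockProjection_eq_self htf.out hd]

lemma fockProj_coe (g : fockSpace n p t) : fockProj n p t g = g := by
  ext1
  exact Lp.ext ((coeFn_fockProj _).trans (coeFn_fockSpace g).symm)

lemma evalLp_fockProj (b : Fin n → ℂ) (u : FockLp n p t) :
    evalLp n p t b (fockProj n p t u) = evalLp n p t b u := by
  have h1 : IsOrderOneIntegrable t (fockProjection n t u) :=
    (memLp_fockProjection hpf.out htf.out (Lp.memLp u)).isOrderOneIntegrable hpf.out htf.out
  have h1' := isOrderOneIntegrable_Lp u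
  rw [evalLp_apply, fockProjection_congr htf.out fock_param_pos (coeFn_fockProj u),
    h1.fockProjection_eq_self htf.out (h1'.differentiable_fockProjection htf.out), evalLp_apply]

instance completeSpace_fockSpace : CompleteSpace (fockSpace n p t) := by
  have hcl : IsClosed (fockSpace n p t : Set (FockLp n p t)) := by
    -- Closedness holds because the Fock space is the fixed-point set of the continuous projection.
    have h : (fockSpace n p t : Set (FockLp n p t))
        = {u | (fockProj n p t u : FockLp n p t) = u} := by
      ext u
      refine ⟨fun hu => congrArg Subtype.val (fockProj_coe ⟨u, hu⟩), fun hu => ?_⟩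
      have hu' : (fockProj n p t u : FockLp n p t) = u := hu
      rw [← hu']
      exact (fockProj n p t u).2
    rw [h]
    exact isClosed_eq (continuous_subtype_val.comp (fockProj n p t).continuous) continuous_id
  exact hcl.completeSpace_coe

/-- Point evaluation on the Fock space. -/
def fockEval (n : ℕ) (p t : ℝ) [hpf : Fact (1 < p)] [htf : Fact (0 < t)] (b : Fin n → ℂ) :
    fockSpace n p t →L[ℂ] ℂ := (evalLp n p t b).comp (fockSpace n p t).subtypeL

lemma fockEval_apply (b : Fin n → ℂ) (g : fockSpace n p t) :
    fockEval n p t b g = evalLp n p t b g := rfl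

lemma fockEval_fockProj (b : Fin n → ℂ) (u : FockLp n p t) :
    fockEval n p t b (fockProj n p t u) = evalLp n p t b u := evalLp_fockProj b u

lemma fockSpace_ext {g g' : fockSpace n p t} (h : ∀ b, fockEval n p t b g = fockEval n p t b g') :
    g = g' := by
  ext1
  refine Lp.ext ((coeFn_fockSpace g).trans (Filter.EventuallyEq.trans ?_ (coeFn_fockSpace g').symm))
  exact Filter.Eventually.of_forall h

lemma exists_norm_fockEval_le (n : ℕ) (p t : ℝ) [Fact (1 < p)] [Fact (0 < t)] :
    ∃ C : ℝ, 0 ≤ C ∧ ∀ b, ‖fockEval n p t b‖ * fockWeight t b ≤ C := by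
  obtain ⟨C, hC, h⟩ := exists_norm_evalLp_le n p t
  refine ⟨C, hC, fun b => le_trans ?_ (h b)⟩
  refine mul_le_mul_of_nonneg_right ?_ (fockWeight_pos t b).le
  refine (ContinuousLinearMap.opNorm_comp_le _ _).trans ?_
  exact mul_le_of_le_one_right (norm_nonneg _) (Submodule.norm_subtypeL_le _)

lemma differentiable_fockEval (g : fockSpace n p t) :
    Differentiable ℂ fun b => fockEval n p t b g := differentiable_evalLp _

/-- Norm continuity is needed for operator-valued integrals. Evaluations are bounded by some `M`
near `b₀`, and the Schwarz lemma, applied to `b ↦ g b` on a unit ball, turns this into a Lipschitz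
bound uniform over `‖g‖ ≤ 1`. -/
lemma continuous_fockEval : Continuous (fockEval n p t) := by
  obtain ⟨C, hC, hle⟩ := exists_norm_fockEval_le n p t
  refine continuous_of_norm_sub_le (E := fockSpace n p t →L[ℂ] ℂ) fun b₀ => ?_
  obtain ⟨M, hM⟩ := (isCompact_closedBall b₀ 1).bddAbove_image
    (f := fun b => C * (fockWeight t b)⁻¹)
    ((continuous_const.mul ((continuous_fockWeight t).inv₀ fun b =>
      (fockWeight_pos t b).ne')).continuousOn)
  have hbd : ∀ b ∈ Metric.closedBall b₀ 1, ‖fockEval n p t b‖ ≤ M := fun b hb => by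
    refine le_trans ?_ (hM (Set.mem_image_of_mem _ hb))
    rw [← div_eq_mul_inv, le_div_iff₀ (fockWeight_pos t b)]
    exact hle b
  have hM0 : 0 ≤ M := 
    le_trans (norm_nonneg (fockEval n p t b₀)) (hbd b₀ (Metric.mem_closedBall_self zero_le_one))
  have hlip : ∀ b ∈ Metric.ball b₀ 1,
      ‖fockEval n p t b - fockEval n p t b₀‖ ≤ 2 * M * dist b b₀ := by
    intro b hb
    refine ContinuousLinearMap.opNorm_le_bound _ (by positivity) fun g => ?_
    have h1 := Complex.dist_le_div_mul_dist_of_mapsTo_ball (R₁ := 1) (R₂ := 2 * M * ‖g‖)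
      (differentiable_fockEval g).differentiableOn (c := b₀) (fun b' hb' => ?_) hb
    · rw [sub_apply, ← dist_eq_norm]
      refine h1.trans_eq (by ring)
    · rw [Metric.mem_closedBall, dist_eq_norm]
      refine (norm_sub_le _ _).trans ?_
      have h2 := ((fockEval n p t b').le_of_opNorm_le (hbd b' (Metric.ball_subset_closedBall hb')) g)
      have h3 := ((fockEval n p t b₀).le_of_opNorm_le
        (hbd b₀ (Metric.mem_closedBall_self zero_le_one)) g)
      linarith
  exact ⟨_, hlip⟩

/-! ### Coherent states -/

omit hpf in
lemma memLp_coherent (hp : 1 < p) (w : Fin n → ℂ) :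
    MemLp (fun z => Complex.exp (hermProd z w / (t : ℂ))) (ENNReal.ofReal p)
      (gaussianMeasure n (2 * t / p)) := by
  rw [memLp_gaussianMeasure_iff hp htf.out]
  have h1 : MemLp (fun z => fockWeight t (z - w)) (ENNReal.ofReal p) volume :=
    (memLp_fockWeight (zero_lt_one.trans hp) htf.out).comp_measurePreserving
      (measurePreserving_sub_right volume w)
  refine h1.of_le_mul (c := (fockWeight t w)⁻¹) ?_ (Filter.Eventually.of_forall fun z => ?_)
  · exact ((Complex.continuous_ofReal.comp (continuous_fockWeight t)).mul
      (continuous_exp_hermProd_left t w)).aestronglyMeasurable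
  · rw [← norm_exp_hermProd_mul_fockWeight, norm_mul, Complex.norm_real,
      Real.norm_of_nonneg (fockWeight_pos t z).le, Real.norm_of_nonneg
      (by have := fockWeight_pos t z; have := fockWeight_pos t w; positivity)]
    refine le_of_eq ?_
    have := (fockWeight_pos t w).ne'
    field_simp

/-- The coherent state `z ↦ exp (z · w̄ / t)`. -/
def coherent (n : ℕ) (p t : ℝ) [hpf : Fact (1 < p)] [htf : Fact (0 < t)] (w : Fin n → ℂ) :
    fockSpace n p t :=
  ⟨(memLp_coherent hpf.out w).toLp _, fun z => Complex.exp (hermProd z w / (t : ℂ)),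
    fun z => (hasFDerivAt_exp_hermProd t w z).differentiableAt,
    MemLp.coeFn_toLp (memLp_coherent hpf.out w)⟩

lemma coeFn_coherent (w : Fin n → ℂ) :
    ((coherent n p t w : FockLp n p t) : (Fin n → ℂ) → ℂ) =ᵐ[gaussianMeasure n (2 * t / p)]
      fun z => Complex.exp (hermProd z w / (t : ℂ)) := MemLp.coeFn_toLp (memLp_coherent hpf.out w)

lemma fockEval_coherent (b w : Fin n → ℂ) :
    fockEval n p t b (coherent n p t w) = Complex.exp (hermProd b w / (t : ℂ)) := by
  have h1 : IsOrderOneIntegrable t (fun z => Complex.exp (hermProd z w / (t : ℂ))) :=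
    (memLp_coherent hpf.out w).isOrderOneIntegrable hpf.out htf.out
  rw [fockEval_apply, evalLp_apply, fockProjection_congr htf.out fock_param_pos (coeFn_coherent w),
    h1.fockProjection_eq_self htf.out fun z => (hasFDerivAt_exp_hermProd t w z).differentiableAt]

/-- The weighted modulus of `K_w` is a translate of `fockWeight` divided by `fockWeight t w`, so the
product in question does not depend on `w`. -/
lemma exists_norm_coherent_le (n : ℕ) (p t : ℝ) [hpf : Fact (1 < p)] [htf : Fact (0 < t)] :
    ∃ C : ℝ, 0 ≤ C ∧ ∀ w, ‖coherent n p t w‖ * fockWeight t w ≤ C := by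
  have hp0 : 0 < p := zero_lt_one.trans hpf.out
  have hW := memLp_fockWeight (n := n) hp0 htf.out
  refine ⟨(fockConst n p t * eLpNorm (fun z : Fin n → ℂ => fockWeight t z)
    (ENNReal.ofReal p) volume).toReal, ENNReal.toReal_nonneg, fun w => ?_⟩
  have h1 : ‖coherent n p t w‖
      = (eLpNorm (fun z => Complex.exp (hermProd z w / (t : ℂ))) (ENNReal.ofReal p)
        (gaussianMeasure n (2 * t / p))).toReal := Lp.norm_toLp _ (memLp_coherent hpf.out w)
  have h2 : eLpNorm (fun z => (fockWeight t z : ℂ) * Complex.exp (hermProd z w / (t : ℂ)))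
      (ENNReal.ofReal p) volume
      = ENNReal.ofReal (fockWeight t w)⁻¹ * eLpNorm (fun z : Fin n → ℂ => fockWeight t z)
        (ENNReal.ofReal p) volume := by
    rw [← eLpNorm_comp_measurePreserving hW.1 (measurePreserving_sub_right volume w),
      Real.enorm_of_nonneg (inv_nonneg.2 (fockWeight_pos t w).le) |>.symm, ← eLpNorm_const_smul]
    refine eLpNorm_congr_norm_ae (Filter.Eventually.of_forall fun z => ?_)
    simp only [Pi.smul_apply, Function.comp_apply, smul_eq_mul]
    rw [← norm_exp_hermProd_mul_fockWeight, norm_mul, Complex.norm_real,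
      Real.norm_of_nonneg (fockWeight_pos t z).le, Real.norm_of_nonneg
      (by have := fockWeight_pos t z; have := fockWeight_pos t w; positivity)]
    have := (fockWeight_pos t w).ne'
    field_simp
  rw [h1, eLpNorm_gaussianMeasure hpf.out htf.out, h2, mul_left_comm, ENNReal.toReal_mul,
    ENNReal.toReal_ofReal (inv_nonneg.2 (fockWeight_pos t w).le), mul_right_comm,
    inv_mul_cancel₀ (fockWeight_pos t w).ne', one_mul]

omit hpf in
lemma memLp_exp_mul_sumNorm (hp : 1 < p) (M : ℝ) :
    MemLp (fun z : Fin n → ℂ => (Real.exp (M * sumNorm z) : ℂ)) (ENNReal.ofReal p)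
      (gaussianMeasure n (2 * t / p)) := by
  rw [memLp_gaussianMeasure_iff hp htf.out]
  have h : MemLp (fun w : Fin n → ℂ => ((Real.exp (M * sumNorm w) * fockWeight t w : ℝ) : ℂ))
      (ENNReal.ofReal p) volume :=
    (memLp_exp_mul_sumNorm_mul_fockWeight (zero_lt_one.trans hp) htf.out M).ofReal (K := ℂ)
  refine h.congr_norm ((Complex.continuous_ofReal.comp (continuous_fockWeight t)).mul
    (Complex.continuous_ofReal.comp (Real.continuous_exp.comp
      (continuous_sumNorm.const_mul M)))).aestronglyMeasurable
    (Filter.Eventually.of_forall fun z => ?_)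
  rw [Complex.ofReal_mul, mul_comm]

lemma hermProd_conj_symm_norm_le (z w : Fin n → ℂ) : ‖hermProd z w‖ ≤ ‖w‖ * sumNorm z := by
  rw [← conj_hermProd, RCLike.norm_conj]
  exact norm_hermProd_le w z

lemma continuous_coherent : Continuous (coherent n p t) := by
  have ht := htf.out
  refine continuous_of_norm_sub_le fun w₀ => ?_
  set R : ℝ := ‖w₀‖ + 1
  set M : ℝ := R / t
  -- A single `L^p` function that dominates all difference quotients of `w ↦ K_w` on the unit ball
  -- about `w₀`; the `+ 1` absorbs the linear factor `sumNorm z`.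
  set D : FockLp n p t := (memLp_exp_mul_sumNorm hpf.out (M + 1)).toLp _
  have hR : ∀ w ∈ Metric.ball w₀ 1, ‖w‖ ≤ R := fun w hw => by
    rw [Metric.mem_ball, dist_eq_norm] at hw
    have := norm_le_norm_add_norm_sub' w w₀
    simp only [R]; linarith
  have hlip : ∀ w ∈ Metric.ball w₀ 1,
      ‖coherent n p t w - coherent n p t w₀‖ ≤ (t⁻¹ * ‖w - w₀‖) * ‖D‖ := by
    intro w hw
    change ‖(coherent n p t w : FockLp n p t) - coherent n p t w₀‖ ≤ _
    refine Lp.norm_le_mul_norm_of_ae_le_mul ?_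
    filter_upwards [coeFn_coherent (p := p) (t := t) w, coeFn_coherent (p := p) (t := t) w₀,
      Lp.coeFn_sub (coherent n p t w : FockLp n p t) (coherent n p t w₀),
      MemLp.coeFn_toLp (memLp_exp_mul_sumNorm (n := n) (t := t) hpf.out (M + 1))] with z h1 h2 h3 h4
    rw [h3, h4, Pi.sub_apply, h1, h2, Complex.norm_real, Real.norm_of_nonneg (Real.exp_pos _).le]
    have hle : ∀ v : Fin n → ℂ, ‖v‖ ≤ R → ‖hermProd z v / (t : ℂ)‖ ≤ M * sumNorm z := by
      intro v hv
      rw [norm_div, Complex.norm_real, Real.norm_of_nonneg ht.le, div_mul_eq_mul_div]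
      refine div_le_div_of_nonneg_right ((hermProd_conj_symm_norm_le z v).trans ?_) ht.le
      exact mul_le_mul_of_nonneg_right hv (sumNorm_nonneg z)
    refine (norm_exp_sub_exp_le (hle w (hR w hw))
      (hle w₀ (hR w₀ (Metric.mem_ball_self one_pos)))).trans ?_
    have h5 : hermProd z w / (t : ℂ) - hermProd z w₀ / (t : ℂ) = hermProd z (w - w₀) / (t : ℂ) := by
      rw [← sub_div]
      congr 1
      rw [sub_eq_iff_eq_add, ← hermProd_add_right, sub_add_cancel]
    rw [h5, norm_div, Complex.norm_real, Real.norm_of_nonneg ht.le, add_mul, one_mul, Real.exp_add]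
    have h6 := hermProd_conj_symm_norm_le z (w - w₀)
    have h7 : sumNorm z ≤ Real.exp (sumNorm z) := by linarith [Real.add_one_le_exp (sumNorm z)]
    calc Real.exp (M * sumNorm z) * (‖hermProd z (w - w₀)‖ / t)
        ≤ Real.exp (M * sumNorm z) * (‖w - w₀‖ * Real.exp (sumNorm z) / t) := by
          gcongr
          exact h6.trans (by gcongr)
      _ = t⁻¹ * ‖w - w₀‖ * (Real.exp (M * sumNorm z) * Real.exp (sumNorm z)) := by
          field_simp
  refine ⟨t⁻¹ * ‖D‖, fun w hw => (hlip w hw).trans_eq ?_⟩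
  rw [dist_eq_norm, mul_right_comm]

/-! ### Polarisation -/

/-- Coordinatewise complex conjugation. -/
def conjVec (z : Fin n → ℂ) : Fin n → ℂ := fun i => conj (z i)

lemma continuous_conjVec : Continuous (conjVec : (Fin n → ℂ) → _) :=
  continuous_pi fun i => Complex.continuous_conj.comp (continuous_apply i)

/-- `K_w` depends antiholomorphically on `w`; conjugating the parameter makes the dependence
holomorphic. -/
lemma differentiable_coherent_line (a u : Fin n → ℂ) :
    Differentiable ℂ fun ζ : ℂ => coherent n p t (conjVec (a + ζ • u)) := by
  refine differentiable_of_separating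
    (continuous_coherent.comp (continuous_conjVec.comp
      (show Continuous fun ζ : ℂ => a + ζ • u by fun_prop)))
    (fockEval n p t) (fun g hg => fockSpace_ext fun b => by rw [hg b, map_zero]) fun b => ?_
  simp only [fockEval_coherent, hermProd, conjVec, Complex.conj_conj, Pi.add_apply, Pi.smul_apply,
    smul_eq_mul]
  fun_prop

lemma differentiable_fockEval_line (b v : Fin n → ℂ) :
    Differentiable ℂ fun ζ : ℂ => fockEval n p t (b + ζ • v) := by
  refine differentiable_of_separating (E := fockSpace n p t →L[ℂ] ℂ)
    (f := fun ζ : ℂ => fockEval n p t (b + ζ • v)) (continuous_fockEval.comp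
      (show Continuous fun ζ : ℂ => b + ζ • v by fun_prop))
    (fun g : fockSpace n p t => ContinuousLinearMap.apply ℂ ℂ g)
    (fun ℓ hℓ => ContinuousLinearMap.ext fun g => by simpa using hℓ g) fun g => ?_
  exact (differentiable_fockEval g).comp (show Differentiable ℂ fun ζ : ℂ => b + ζ • v by fun_prop)

/-- The hypothesis `h` makes the two complex lines meet the diagonal over all real parameters, where
`B` vanishes; the identity theorem in one variable carries the vanishing to the parameter `I`. -/
lemma bilinear_line_eq_zero (B : fockSpace n p t →L[ℂ] (fockSpace n p t →L[ℂ] ℂ) →L[ℂ] ℂ)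
    (hB : ∀ w, B (coherent n p t w) (fockEval n p t w) = 0) (a u b v : Fin n → ℂ)
    (h : ∀ x : ℝ, conjVec (a + (x : ℂ) • u) = b + (x : ℂ) • v) :
    B (coherent n p t (conjVec (a + Complex.I • u))) (fockEval n p t (b + Complex.I • v)) = 0 := by
  refine bilinear_eq_zero_of_real_eq_zero (E := fockSpace n p t) (E' := fockSpace n p t →L[ℂ] ℂ) B
    (f := fun ζ => coherent n p t (conjVec (a + ζ • u)))
    (g := fun ζ => fockEval n p t (b + ζ • v)) (differentiable_coherent_line a u)
    (differentiable_fockEval_line b v) (fun x => ?_) Complex.I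
  rw [h x]
  exact hB _

/-- A bounded bilinear form which vanishes on all pairs `(K_w, δ_w)` vanishes on all pairs
`(K_a, δ_b)`. -/
lemma polarization (B : fockSpace n p t →L[ℂ] (fockSpace n p t →L[ℂ] ℂ) →L[ℂ] ℂ)
    (hB : ∀ w, B (coherent n p t w) (fockEval n p t w) = 0) (a b : Fin n → ℂ) :
    B (coherent n p t a) (fockEval n p t b) = 0 := by
  -- Write `b = X + iY` and `conj a = X - iY`, and split `X = x₁ + i x₂`, `Y = y₁ + i y₂` with real
  -- vectors. The lines `(x₁ ± i y₁) + ζ (x₂ ± i y₂)` are conjugate for real `ζ` and pass through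
  -- `b` and `conj a` at `ζ = i`. One complex parameter thus suffices in every dimension.
  obtain ⟨x₁, hx₁⟩ : ∃ x : Fin n → ℝ, ∀ i, x i = ((conj (a i) + b i) / 2).re := ⟨_, fun _ => rfl⟩
  obtain ⟨x₂, hx₂⟩ : ∃ x : Fin n → ℝ, ∀ i, x i = ((conj (a i) + b i) / 2).im := ⟨_, fun _ => rfl⟩
  obtain ⟨y₁, hy₁⟩ : ∃ x : Fin n → ℝ, ∀ i, x i = ((b i - conj (a i)) / (2 * Complex.I)).re :=
    ⟨_, fun _ => rfl⟩
  obtain ⟨y₂, hy₂⟩ : ∃ x : Fin n → ℝ, ∀ i, x i = ((b i - conj (a i)) / (2 * Complex.I)).im :=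
    ⟨_, fun _ => rfl⟩
  have hx : ∀ i, (x₁ i : ℂ) + Complex.I * x₂ i = (conj (a i) + b i) / 2 := fun i => by
    rw [hx₁, hx₂, mul_comm Complex.I]
    exact Complex.re_add_im _
  have hy : ∀ i, Complex.I * ((y₁ i : ℂ) + Complex.I * y₂ i) = (b i - conj (a i)) / 2 := fun i => by
    rw [hy₁, hy₂, mul_comm Complex.I (Complex.ofReal _), Complex.re_add_im]
    field_simp
  have key := bilinear_line_eq_zero B hB (fun i => (x₁ i : ℂ) - Complex.I * y₁ i)
    (fun i => (x₂ i : ℂ) - Complex.I * y₂ i) (fun i => (x₁ i : ℂ) + Complex.I * y₁ i)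
    (fun i => (x₂ i : ℂ) + Complex.I * y₂ i) fun x => by
      funext i
      simp only [conjVec, Pi.add_apply, Pi.smul_apply, smul_eq_mul,
        map_add, map_sub, map_mul, Complex.conj_ofReal, Complex.conj_I]
      ring
  have ha : conjVec ((fun i => (x₁ i : ℂ) - Complex.I * y₁ i)
      + Complex.I • fun i => (x₂ i : ℂ) - Complex.I * y₂ i) = a := by
    funext i
    simp only [conjVec, Pi.add_apply, Pi.smul_apply, smul_eq_mul]
    rw [← Complex.conj_conj (a i)]
    congr 1
    linear_combination hx i - hy i
  have hb : ((fun i => (x₁ i : ℂ) + Complex.I * y₁ i)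
      + Complex.I • fun i => (x₂ i : ℂ) + Complex.I * y₂ i) = b := by
    funext i
    simp only [Pi.add_apply, Pi.smul_apply, smul_eq_mul]
    linear_combination hx i + hy i
  rwa [ha, hb] at key

end FockOperators

/-! ### Multiplication operators on `Lᵖ` -/

section Multiplication

variable {X : Type*} [TopologicalSpace X] [MeasurableSpace X] [OpensMeasurableSpace X]
  {μ : Measure X} {P : ENNReal}

lemma memLp_bcf_mul (f : X →ᵇ ℂ) {u : X → ℂ} (hu : MemLp u P μ) :
    MemLp (fun x => f x * u x) P μ := by
  refine hu.of_le_mul (c := ‖f‖) (f.continuous.aestronglyMeasurable.mul hu.1)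
    (Filter.Eventually.of_forall fun x => ?_)
  rw [norm_mul]
  exact mul_le_mul_of_nonneg_right (f.norm_coe_le_norm x) (norm_nonneg _)

variable [hP : Fact (1 ≤ P)]

/-- Multiplication by a bounded continuous function on `Lᵖ`. -/
def mulLp (μ : Measure X) (P : ENNReal) [Fact (1 ≤ P)] (f : X →ᵇ ℂ) :
    Lp ℂ P μ →L[ℂ] Lp ℂ P μ :=
  LinearMap.mkContinuous
    { toFun := fun u => (memLp_bcf_mul f (Lp.memLp u)).toLp _
      map_add' := fun u v => by
        refine Lp.ext ?_
        filter_upwards [MemLp.coeFn_toLp (memLp_bcf_mul f (Lp.memLp u)),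
          MemLp.coeFn_toLp (memLp_bcf_mul f (Lp.memLp v)),
          MemLp.coeFn_toLp (memLp_bcf_mul f (Lp.memLp (u + v))), Lp.coeFn_add u v,
          Lp.coeFn_add ((memLp_bcf_mul f (Lp.memLp u)).toLp _)
            ((memLp_bcf_mul f (Lp.memLp v)).toLp _)] with x h1 h2 h3 h4 h5
        rw [h3, h5, Pi.add_apply, h1, h2, h4, Pi.add_apply, mul_add]
      map_smul' := fun c u => by
        refine Lp.ext ?_
        filter_upwards [MemLp.coeFn_toLp (memLp_bcf_mul f (Lp.memLp u)),
          MemLp.coeFn_toLp (memLp_bcf_mul f (Lp.memLp (c • u))), Lp.coeFn_smul c u,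
          Lp.coeFn_smul c ((memLp_bcf_mul f (Lp.memLp u)).toLp _)] with x h1 h2 h3 h4
        rw [RingHom.id_apply, h2, h4, Pi.smul_apply, h1, h3, Pi.smul_apply, smul_eq_mul,
          smul_eq_mul, mul_left_comm] } ‖f‖ fun u => by
    refine Lp.norm_le_mul_norm_of_ae_le_mul ?_
    filter_upwards [MemLp.coeFn_toLp (memLp_bcf_mul f (Lp.memLp u))] with x h1
    refine (le_of_eq (congrArg _ h1)).trans ?_
    rw [norm_mul]
    exact mul_le_mul_of_nonneg_right (f.norm_coe_le_norm x) (norm_nonneg _)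

lemma coeFn_mulLp (f : X →ᵇ ℂ) (u : Lp ℂ P μ) : mulLp μ P f u =ᵐ[μ] fun x => f x * u x :=
  MemLp.coeFn_toLp (memLp_bcf_mul f (Lp.memLp u))

lemma norm_mulLp_le (f : X →ᵇ ℂ) : ‖mulLp μ P f‖ ≤ ‖f‖ :=
  LinearMap.mkContinuous_norm_le _ (norm_nonneg _) _

lemma mulLp_mul (f g : X →ᵇ ℂ) (u : Lp ℂ P μ) :
    mulLp μ P (f * g) u = mulLp μ P f (mulLp μ P g u) := by
  refine Lp.ext ?_
  filter_upwards [coeFn_mulLp (f * g) u, coeFn_mulLp f (mulLp μ P g u), coeFn_mulLp g u]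
    with x h1 h2 h3
  rw [h1, h2, h3, BoundedContinuousFunction.mul_apply, mul_assoc]

lemma mulLp_one_sub (f : X →ᵇ ℂ) (u : Lp ℂ P μ) : mulLp μ P (1 - f) u = u - mulLp μ P f u := by
  refine Lp.ext ?_
  filter_upwards [coeFn_mulLp (1 - f) u, coeFn_mulLp f u, Lp.coeFn_sub u (mulLp μ P f u)]
    with x h1 h2 h3
  rw [h1, h3, Pi.sub_apply, h2, BoundedContinuousFunction.sub_apply,
    BoundedContinuousFunction.coe_one, Pi.one_apply, sub_mul, one_mul]

/-- Multiplication by functions tending boundedly to `0` tends strongly to `0`. -/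
lemma tendsto_mulLp_zero (hPt : P ≠ ⊤) {ψ : ℕ → X →ᵇ ℂ} (h1 : ∀ m, ‖ψ m‖ ≤ 1)
    (h0 : ∀ x, Filter.Tendsto (fun m => ψ m x) Filter.atTop (nhds 0)) (u : Lp ℂ P μ) :
    Filter.Tendsto (fun m => mulLp μ P (ψ m) u) Filter.atTop (nhds 0) := by
  have hP0 : P ≠ 0 := (zero_lt_one.trans_le hP.out).ne'
  have hPr : 0 < P.toReal := ENNReal.toReal_pos hP0 hPt
  have hu := (eLpNorm_lt_top_iff_lintegral_rpow_enorm_lt_top hP0 hPt).1 (Lp.memLp u).2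
  have hlim : Filter.Tendsto (fun m => ∫⁻ x, ‖ψ m x * u x‖ₑ ^ P.toReal ∂μ) Filter.atTop
      (nhds (∫⁻ _, 0 ∂μ)) := by
    refine tendsto_lintegral_of_dominated_convergence' (fun x => ‖u x‖ₑ ^ P.toReal)
      (fun m => (((ψ m).continuous.aestronglyMeasurable.mul
        (Lp.aestronglyMeasurable u)).enorm.pow_const _)) (fun m => ?_) hu.ne ?_
    · refine Filter.Eventually.of_forall fun x => ENNReal.rpow_le_rpow ?_ hPr.le
      rw [enorm_mul]
      refine mul_le_of_le_one_left' ?_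
      rw [← ofReal_norm, ENNReal.ofReal_le_one]
      exact ((ψ m).norm_coe_le_norm x).trans (h1 m)
    · refine Filter.Eventually.of_forall fun x => ?_
      have h2 : Filter.Tendsto (fun m => ‖ψ m x * u x‖ₑ) Filter.atTop (nhds 0) := by
        have := ((h0 x).mul_const (u x)).enorm
        simpa using this
      have h3 := (ENNReal.continuous_rpow_const (y := P.toReal)).tendsto 0 |>.comp h2
      simpa [ENNReal.zero_rpow_of_pos hPr, Function.comp_def] using h3
  rw [lintegral_zero] at hlim
  have h4 := (ENNReal.continuous_rpow_const (y := 1 / P.toReal)).tendsto 0 |>.comp hlim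
  rw [ENNReal.zero_rpow_of_pos (by positivity)] at h4
  rw [tendsto_zero_iff_norm_tendsto_zero]
  have h5 := (ENNReal.tendsto_toReal ENNReal.zero_ne_top).comp h4
  rw [ENNReal.toReal_zero] at h5
  refine h5.congr fun m => ?_
  rw [Lp.norm_def, eLpNorm_congr_ae (coeFn_mulLp (ψ m) u),
    eLpNorm_eq_lintegral_rpow_enorm_toReal hP0 hPt]
  rfl

omit [TopologicalSpace X] [OpensMeasurableSpace X] in
/-- The norm of a sum of two functions with disjoint supports. -/
lemma norm_add_le_of_disjoint (hPt : P ≠ ⊤) {f g : Lp ℂ P μ} (hf : ‖f‖ ≤ 1) (hg : ‖g‖ ≤ 1)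
    (h : ∀ᵐ x ∂μ, f x = 0 ∨ g x = 0) : ‖f + g‖ ≤ 2 ^ (1 / P.toReal) := by
  have hP0 : P ≠ 0 := (zero_lt_one.trans_le hP.out).ne'
  have hPr : 0 < P.toReal := ENNReal.toReal_pos hP0 hPt
  have key : ∀ f : Lp ℂ P μ, ‖f‖ ≤ 1 → ∫⁻ x, ‖f x‖ₑ ^ P.toReal ∂μ ≤ 1 := by
    intro f hf
    have h1 : eLpNorm f P μ ≤ 1 := by
      rw [Lp.norm_def] at hf
      rw [← ENNReal.ofReal_toReal (Lp.memLp f).2.ne]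
      exact ENNReal.ofReal_le_one.2 hf
    rw [eLpNorm_eq_lintegral_rpow_enorm_toReal hP0 hPt] at h1
    have h2 := ENNReal.rpow_le_rpow h1 hPr.le
    rwa [← ENNReal.rpow_mul, one_div_mul_cancel hPr.ne', ENNReal.rpow_one, ENNReal.one_rpow] at h2
  have h1 : ∫⁻ x, ‖(f + g : Lp ℂ P μ) x‖ₑ ^ P.toReal ∂μ ≤ 2 := by
    calc ∫⁻ x, ‖(f + g : Lp ℂ P μ) x‖ₑ ^ P.toReal ∂μ
        = ∫⁻ x, (‖f x‖ₑ ^ P.toReal + ‖g x‖ₑ ^ P.toReal) ∂μ := by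
          refine lintegral_congr_ae ?_
          filter_upwards [h, Lp.coeFn_add f g] with x hx hadd
          rw [hadd, Pi.add_apply]
          rcases hx with hx | hx <;> simp [hx, hPr]
      _ = ∫⁻ x, ‖f x‖ₑ ^ P.toReal ∂μ + ∫⁻ x, ‖g x‖ₑ ^ P.toReal ∂μ :=
          lintegral_add_left' ((Lp.aestronglyMeasurable f).enorm.pow_const _) _
      _ ≤ 1 + 1 := add_le_add (key f hf) (key g hg)
      _ = 2 := one_add_one_eq_two
  rw [Lp.norm_def, eLpNorm_eq_lintegral_rpow_enorm_toReal hP0 hPt]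
  have h2 := ENNReal.toReal_mono (ENNReal.rpow_ne_top_of_nonneg (by positivity)
    (ENNReal.ofNat_ne_top (n := 2))) (ENNReal.rpow_le_rpow h1 (show 0 ≤ 1 / P.toReal by positivity))
  refine h2.trans_eq ?_
  rw [← ENNReal.toReal_rpow, ENNReal.toReal_ofNat]

lemma exists_unit_mul_eq_norm (z : ℂ) : ∃ s : ℂ, ‖s‖ = 1 ∧ s * z = ‖z‖ := by
  by_cases hz : z = 0
  · exact ⟨1, by simp, by simp [hz]⟩
  · refine ⟨conj z / ‖z‖, ?_, ?_⟩
    · rw [norm_div, RCLike.norm_conj, Complex.norm_real, norm_norm, div_self (norm_ne_zero_iff.2 hz)]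
    · have : (‖z‖ : ℂ) ≠ 0 := Complex.ofReal_ne_zero.2 (norm_ne_zero_iff.2 hz)
      rw [div_mul_eq_mul_div, Complex.conj_mul', sq, mul_div_assoc, div_self this, mul_one]

/-- A bounded functional on `Lᵖ`, `1 < p < ∞`, is uniformly small on functions supported near
infinity. -/
lemma tendsto_norm_comp_mulLp_zero (hP1 : 1 < P) (hPt : P ≠ ⊤) {ψ : ℕ → X →ᵇ ℂ}
    (h1 : ∀ m, ‖ψ m‖ ≤ 1) (h1' : ∀ m, ‖1 - ψ m‖ ≤ 1)
    (h0 : ∀ x, Filter.Tendsto (fun m => ψ m x) Filter.atTop (nhds 0))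
    (hmul : ∀ m j, m < j → ψ m * ψ j = ψ j) (Λ : Lp ℂ P μ →L[ℂ] ℂ) :
    Filter.Tendsto (fun m => ‖Λ.comp (mulLp μ P (ψ m))‖) Filter.atTop (nhds 0) := by
  have hPr : 1 < P.toReal := by
    rw [← ENNReal.toReal_one]
    exact (ENNReal.toReal_lt_toReal ENNReal.one_ne_top hPt).2 hP1
  have hM1 : ∀ (m : ℕ) (u : Lp ℂ P μ), ‖mulLp μ P (ψ m) u‖ ≤ ‖u‖ := fun m u => by
    have := (mulLp μ P (ψ m)).le_of_opNorm_le ((norm_mulLp_le (ψ m)).trans (h1 m)) u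
    rwa [one_mul] at this
  set a : ℕ → ℝ := fun m => ‖Λ.comp (mulLp μ P (ψ m))‖ with ha
  have hanti : Antitone a := by
    refine antitone_nat_of_succ_le fun m => ?_
    refine ContinuousLinearMap.opNorm_le_bound _ (norm_nonneg _) fun u => ?_
    rw [ContinuousLinearMap.comp_apply, ← hmul m (m + 1) (Nat.lt_succ_self m), mulLp_mul,
      ← ContinuousLinearMap.comp_apply]
    exact (ContinuousLinearMap.le_opNorm _ _).trans
      (mul_le_mul_of_nonneg_left (hM1 _ u) (norm_nonneg _))
  have hbdd : BddBelow (Set.range a) := ⟨0, by rintro _ ⟨m, rfl⟩; exact norm_nonneg _⟩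
  have hlim := tendsto_atTop_ciInf hanti hbdd
  set c : ℝ := ⨅ m, a m
  have hca : ∀ m, c ≤ a m := fun m => ciInf_le hbdd m
  have hc0 : 0 ≤ c := le_ciInf fun m => norm_nonneg _
  -- If the limit `c` were positive, two humps with disjoint supports, each nearly realising `c`,
  -- would contradict the `L^p` bound on the norm of their sum.
  rcases hc0.eq_or_lt with hc | hc
  · rwa [← hc] at hlim
  exfalso
  set r : ℝ := 2 ^ (1 / P.toReal) with hr
  have hr2 : r < 2 := by
    have := Real.rpow_lt_rpow_of_exponent_lt (x := 2) one_lt_two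
      (show 1 / P.toReal < 1 by rw [div_lt_one (by linarith)]; exact hPr)
    rwa [Real.rpow_one] at this
  have hr0 : 0 < r := by positivity
  -- Chosen so that `2(c - ε) - (c + ε) r = (2 - r) c / 2 > 0`; `r < 2` is where `P > 1` enters.
  set ε : ℝ := (2 - r) * c / (2 * (2 + r)) with hε
  have hε0 : 0 < ε := div_pos (mul_pos (by linarith) hc) (by positivity)
  obtain ⟨m, hm⟩ := (hlim.eventually (gt_mem_nhds (show c < c + ε by linarith))).exists
  obtain ⟨g, hg, hΛg⟩ := (Λ.comp (mulLp μ P (ψ (m + 1)))).exists_lt_apply_of_lt_opNorm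
    (show c - ε < _ from (by linarith : c - ε < c).trans_le (hca (m + 1)))
  rw [ContinuousLinearMap.comp_apply] at hΛg
  set h := mulLp μ P (ψ (m + 1)) g with hh
  have hhn : ‖h‖ ≤ 1 := (hM1 _ g).trans hg.le
  -- Cutting off the far part of the first hump changes `Λ h` arbitrarily little, which leaves room
  -- at infinity for the second.
  have happ : Filter.Tendsto (fun k => ‖Λ (mulLp μ P (1 - ψ k) h)‖) Filter.atTop
      (nhds ‖Λ h‖) := by
    have h3 := (tendsto_const_nhds (x := h)).sub (tendsto_mulLp_zero hPt h1 h0 h)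
    rw [sub_zero] at h3
    simp only [mulLp_one_sub]
    exact ((Λ.continuous.tendsto h).comp h3).norm
  obtain ⟨k, hk1, hk2⟩ := ((happ.eventually (lt_mem_nhds hΛg)).and
    (Filter.eventually_ge_atTop m)).exists
  obtain ⟨g', hg', hΛg'⟩ := (Λ.comp (mulLp μ P (ψ (k + 1)))).exists_lt_apply_of_lt_opNorm
    (show c - ε < _ from (by linarith : c - ε < c).trans_le (hca (k + 1)))
  rw [ContinuousLinearMap.comp_apply] at hΛg'
  set v₁ := mulLp μ P (1 - ψ k) h with hv₁
  set v₂ := mulLp μ P (ψ (k + 1)) g' with hv₂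
  have hv₁n : ‖v₁‖ ≤ 1 := by
    have := (mulLp μ P (1 - ψ k)).le_of_opNorm_le ((norm_mulLp_le _).trans (h1' k)) h
    rw [one_mul] at this
    exact this.trans hhn
  have hv₂n : ‖v₂‖ ≤ 1 := (hM1 _ g').trans hg'.le
  obtain ⟨s₁, hs₁, hs₁'⟩ := exists_unit_mul_eq_norm (Λ v₁)
  obtain ⟨s₂, hs₂, hs₂'⟩ := exists_unit_mul_eq_norm (Λ v₂)
  -- Where `ψ (k+1)` is nonzero, the relation `ψ k * ψ (k+1) = ψ (k+1)` forces `ψ k = 1`.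
  have hdisj : ∀ᵐ x ∂μ, (s₁ • v₁ : Lp ℂ P μ) x = 0 ∨ (s₂ • v₂ : Lp ℂ P μ) x = 0 := by
    filter_upwards [coeFn_mulLp (1 - ψ k) h, coeFn_mulLp (ψ (k + 1)) g', Lp.coeFn_smul s₁ v₁,
      Lp.coeFn_smul s₂ v₂] with x hx₁ hx₂ hx₃ hx₄
    rw [hx₃, hx₄, Pi.smul_apply, Pi.smul_apply, hv₁, hv₂, hx₁, hx₂,
      BoundedContinuousFunction.sub_apply, BoundedContinuousFunction.coe_one, Pi.one_apply]
    have h3 := DFunLike.congr_fun (hmul k (k + 1) (Nat.lt_succ_self k)) x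
    rw [BoundedContinuousFunction.mul_apply] at h3
    by_cases h4 : ψ (k + 1) x = 0
    · right; simp [h4]
    · left
      rw [mul_left_eq_self₀.1 h3 |>.resolve_right h4]
      simp
  -- Both humps lie where `ψ m` acts as the identity, so the sum is controlled by `a m < c + ε` and
  -- not merely by `‖Λ‖`.
  have hfix : mulLp μ P (ψ m) (s₁ • v₁ + s₂ • v₂) = s₁ • v₁ + s₂ • v₂ := by
    have hv₁' : v₁ = mulLp μ P ((1 - ψ k) * ψ (m + 1)) g := (mulLp_mul _ _ g).symm
    rw [map_add, map_smul, map_smul, hv₁', hv₂, ← mulLp_mul, ← mulLp_mul,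
      hmul m (k + 1) (Nat.lt_succ_of_le hk2), mul_left_comm (ψ m),
      hmul m (m + 1) (Nat.lt_succ_self m)]
  have hnorm : ‖s₁ • v₁ + s₂ • v₂‖ ≤ r :=
    norm_add_le_of_disjoint hPt (by rwa [norm_smul, hs₁, one_mul])
      (by rwa [norm_smul, hs₂, one_mul]) hdisj
  have hval : Λ (s₁ • v₁ + s₂ • v₂) = ((‖Λ v₁‖ + ‖Λ v₂‖ : ℝ) : ℂ) := by
    rw [map_add, map_smul, map_smul, smul_eq_mul, smul_eq_mul, hs₁', hs₂', Complex.ofReal_add]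
  have hupper : ‖Λ v₁‖ + ‖Λ v₂‖ ≤ a m * r := by
    have h3 := (Λ.comp (mulLp μ P (ψ m))).le_opNorm (s₁ • v₁ + s₂ • v₂)
    rw [ContinuousLinearMap.comp_apply, hfix, hval, Complex.norm_real,
      Real.norm_of_nonneg (by positivity)] at h3
    exact h3.trans (mul_le_mul_of_nonneg_left hnorm (norm_nonneg _))
  have h5 : a m * r ≤ (c + ε) * r := mul_le_mul_of_nonneg_right hm.le hr0.le
  have h6 : ε * (2 + r) = (2 - r) * c / 2 := by
    rw [hε]; field_simp
  have h7 : 0 < (2 - r) * c := mul_pos (by linarith) hc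
  nlinarith

end Multiplication

/-! ### Compact operators -/

section Compact

/-- A bounded family of operators tending strongly to zero tends to zero in norm after composition
with a compact operator. -/
lemma tendsto_norm_comp_compact {E F G ι : Type*} [NormedAddCommGroup E] [NormedSpace ℂ E]
    [NormedAddCommGroup F] [NormedSpace ℂ F] [NormedAddCommGroup G] [NormedSpace ℂ G]
    {l : Filter ι} {L : ι → F →L[ℂ] G} {C : ℝ} (hC : ∀ i, ‖L i‖ ≤ C)
    (h0 : ∀ x, Filter.Tendsto (fun i => L i x) l (nhds 0)) {K : E →L[ℂ] F}
    (hK : IsCompactOperator K) :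
    Filter.Tendsto (fun i => ‖(L i).comp K‖) l (nhds 0) := by
  obtain ⟨S, hS, hKS⟩ := hK.image_subset_compact_of_bounded (f := (K : E →ₗ[ℂ] F))
    (Metric.isBounded_closedBall (x := (0 : E)) (r := 1))
  rcases isEmpty_or_nonempty ι with hι | ⟨⟨i₀⟩⟩
  · rw [Filter.filter_eq_bot_of_isEmpty l]; exact Filter.tendsto_bot
  have hC0 : 0 ≤ C := (norm_nonneg _).trans (hC i₀)
  rw [Metric.tendsto_nhds]
  intro ε hε
  -- A finite net of the compact image reduces the claim to finitely many vectors; `C + 1` avoids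
  -- division by zero.
  obtain ⟨T, hTS, hTf, hT⟩ := hS.finite_cover_balls (e := ε / (4 * (C + 1))) (by positivity)
  have hev : ∀ᶠ i in l, ∀ y ∈ T, ‖L i y‖ < ε / 4 := by
    rw [Filter.eventually_all_finite hTf]
    intro y _
    have := (tendsto_zero_iff_norm_tendsto_zero.1 (h0 y)).eventually
      (gt_mem_nhds (show 0 < ε / 4 by positivity))
    exact this
  filter_upwards [hev] with i hi
  rw [dist_zero_right, norm_norm]
  refine lt_of_le_of_lt (ContinuousLinearMap.opNorm_le_of_unit_norm (C := ε / 2) (by positivity)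
    fun x hx => ?_) (by linarith)
  have hxS : K x ∈ S := hKS ⟨x, by simp [hx], rfl⟩
  obtain ⟨y, hyT, hy⟩ := Set.mem_iUnion₂.1 (hT hxS)
  have h1 : ‖L i (K x - y)‖ ≤ C * (ε / (4 * (C + 1))) := by
    refine ((L i).le_of_opNorm_le (hC i) _).trans (mul_le_mul_of_nonneg_left ?_ hC0)
    rw [← dist_eq_norm]
    exact (Metric.mem_ball.1 hy).le
  have h2 : C * (ε / (4 * (C + 1))) ≤ ε / 4 := by
    rw [mul_div_assoc', div_le_div_iff₀ (by positivity) (by positivity)]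
    nlinarith
  have h3 : (L i) (K x) = L i (K x - y) + L i y := by rw [← map_add, sub_add_cancel]
  rw [ContinuousLinearMap.comp_apply, h3]
  exact (norm_add_le _ _).trans (by linarith [hi y hyT])

end Compact

/-! ### Rank-one operators and compact operators -/

section RankOne

variable {E : Type*} [NormedAddCommGroup E] [NormedSpace ℂ E]

/-- The bilinear form `(g, λ) ↦ Φ (λ(·) g)`. -/
def rankOneForm (Φ : (E →L[ℂ] E) →L[ℂ] ℂ) : E →L[ℂ] (E →L[ℂ] ℂ) →L[ℂ] ℂ :=
  (ContinuousLinearMap.compL ℂ (E →L[ℂ] ℂ) (E →L[ℂ] E) ℂ Φ).comp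
    (ContinuousLinearMap.smulRightL ℂ E E).flip

lemma rankOneForm_apply (Φ : (E →L[ℂ] E) →L[ℂ] ℂ) (g : E) (φ : E →L[ℂ] ℂ) :
    rankOneForm Φ g φ = Φ (φ.smulRight g) := rfl

lemma continuous_smulRight {X : Type*} [TopologicalSpace X] {δ : X → E →L[ℂ] ℂ} {K : X → E}
    (hδ : Continuous δ) (hK : Continuous K) : Continuous fun w => (δ w).smulRight (K w) :=
  ((ContinuousLinearMap.smulRightL ℂ E E).continuous.comp hδ).clm_apply hK

/-- A functional vanishing on rank-one operators `δ_b(·) K_a` vanishes on compact operators, if the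
identity is suitably approximated by operators generated by the `δ_w(·) K_w`. -/
lemma apply_compact_eq_zero {X : Type*} (K : X → E) (δ : X → E →L[ℂ] ℂ) (T : ℕ → E →L[ℂ] E)
    (hT : ∀ Θ : (E →L[ℂ] E) →L[ℂ] ℂ, (∀ w, Θ ((δ w).smulRight (K w)) = 0) → ∀ m, Θ (T m) = 0)
    (hstrong : ∀ A : E →L[ℂ] E, IsCompactOperator A →
      Filter.Tendsto (fun m => (T m).comp A) Filter.atTop (nhds A))
    (hdual : ∀ φ : E →L[ℂ] ℂ, Filter.Tendsto (fun m => φ.comp (T m)) Filter.atTop (nhds φ))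
    (Φ : (E →L[ℂ] E) →L[ℂ] ℂ) (hΦ : ∀ a b, Φ ((δ b).smulRight (K a)) = 0)
    (A : E →L[ℂ] E) (hA : IsCompactOperator A) : Φ A = 0 := by
  -- From `δ_b` to arbitrary functionals: composing `φ` with `δ_w ⊗ K_w` gives a multiple of `δ_w`,
  -- so `Φ` kills `(φ ∘ T m) ⊗ K_a`, and `hdual` passes to the limit.
  have h1 : ∀ (a : X) (φ : E →L[ℂ] ℂ), Φ (φ.smulRight (K a)) = 0 := by
    intro a φ
    have hz : ∀ m, rankOneForm Φ (K a) (φ.comp (T m)) = 0 := by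
      refine hT ((rankOneForm Φ (K a)).comp (ContinuousLinearMap.compL ℂ E E ℂ φ)) fun w => ?_
      have h2 : φ.comp ((δ w).smulRight (K w)) = φ (K w) • δ w := by
        ext x; simp [mul_comm]
      rw [ContinuousLinearMap.comp_apply, ContinuousLinearMap.compL_apply, h2, map_smul,
        rankOneForm_apply, hΦ, smul_zero]
    have hlim := ((rankOneForm Φ (K a)).continuous.tendsto φ).comp (hdual φ)
    simp only [Function.comp_def, hz] at hlim
    exact (tendsto_nhds_unique hlim tendsto_const_nhds).trans rfl
  -- From rank one to compact: `(δ_w ⊗ K_w) ∘ A = (δ_w ∘ A) ⊗ K_w` is covered by the previous stage.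
  have hz : ∀ m, Φ ((T m).comp A) = 0 := by
    refine hT (Φ.comp ((ContinuousLinearMap.compL ℂ E E E).flip A)) fun w => ?_
    have h2 : ((δ w).smulRight (K w)).comp A = ((δ w).comp A).smulRight (K w) := by
      ext x; simp
    rw [ContinuousLinearMap.comp_apply, ContinuousLinearMap.flip_apply,
      ContinuousLinearMap.compL_apply, h2, h1]
  have hlim := (Φ.continuous.tendsto A).comp (hstrong A hA)
  simp only [Function.comp_def, hz] at hlim
  exact (tendsto_nhds_unique hlim tendsto_const_nhds).trans rfl

/-- A closed subspace contains every vector killed by all functionals vanishing on it. -/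
lemma mem_of_forall_functional {S : Submodule ℂ E} (hS : IsClosed (S : Set E)) {x : E}
    (h : ∀ Φ : E →L[ℂ] ℂ, (∀ y ∈ S, Φ y = 0) → Φ x = 0) : x ∈ S := by
  by_contra hx
  -- Closedness makes the quotient by `S` a normed space, where Hahn–Banach supplies a norming
  -- functional.
  have : IsClosed (S : Set E) := hS
  have hne : (S.mkQ x) ≠ 0 := by rwa [Ne, Submodule.mkQ_apply, Submodule.Quotient.mk_eq_zero]
  obtain ⟨g, -, hg⟩ := exists_dual_vector'' ℂ (S.mkQ x)
  have h1 := h (g.comp S.mkQL) fun y hy => by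
    have : S.mkQL y = 0 := (Submodule.Quotient.mk_eq_zero S).2 hy
    rw [ContinuousLinearMap.comp_apply, this, map_zero]
  have h2 : g (S.mkQ x) = 0 := h1
  rw [h2] at hg
  exact hne (norm_eq_zero.1 (Complex.ofReal_eq_zero.1 hg.symm))

section Approximation

variable {L : Type*} [NormedAddCommGroup L] [NormedSpace ℂ L] {P : L →L[ℂ] E} {j : E →L[ℂ] L}
  {M : ℕ → L →L[ℂ] L} {T : ℕ → E →L[ℂ] E}

lemma tendsto_apply_of_tail (hT : ∀ m g, T m g = g - P (M m (j g)))
    (hM0 : ∀ u, Filter.Tendsto (fun m => M m u) Filter.atTop (nhds 0)) (g : E) :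
    Filter.Tendsto (fun m => T m g) Filter.atTop (nhds g) := by
  simp only [hT]
  have h := (P.continuous.tendsto 0).comp (hM0 (j g))
  rw [map_zero] at h
  simpa using (tendsto_const_nhds (x := g)).sub h

lemma tendsto_comp_compact_of_tail (hT : ∀ m g, T m g = g - P (M m (j g))) (hM1 : ∀ m, ‖M m‖ ≤ 1)
    (hM0 : ∀ u, Filter.Tendsto (fun m => M m u) Filter.atTop (nhds 0)) {A : E →L[ℂ] E}
    (hA : IsCompactOperator A) :
    Filter.Tendsto (fun m => (T m).comp A) Filter.atTop (nhds A) := by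
  have h := tendsto_norm_comp_compact (l := Filter.atTop)
    (L := fun m => P.comp ((M m).comp j)) (C := ‖P‖ * (1 * ‖j‖)) (fun m => ?_) (fun g => ?_) hA
  · rw [tendsto_iff_norm_sub_tendsto_zero]
    refine h.congr fun m => ?_
    rw [← norm_neg]
    congr 1
    ext1 g
    simp [hT]
  · refine (ContinuousLinearMap.opNorm_comp_le _ _).trans
      (mul_le_mul_of_nonneg_left ?_ (norm_nonneg _))
    exact (ContinuousLinearMap.opNorm_comp_le _ _).trans
      (mul_le_mul_of_nonneg_right (hM1 m) (norm_nonneg _))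
  · have h := (P.continuous.tendsto 0).comp (hM0 (j g))
    rwa [map_zero] at h

/-- The error `φ - φ ∘ T m` factors through the functional `φ ∘ P` on `L` restricted to tails, which
`hMd` makes small in norm. -/
lemma tendsto_functional_comp_of_tail (hT : ∀ m g, T m g = g - P (M m (j g)))
    (hMd : ∀ Λ : L →L[ℂ] ℂ, Filter.Tendsto (fun m => ‖Λ.comp (M m)‖) Filter.atTop (nhds 0))
    (φ : E →L[ℂ] ℂ) : Filter.Tendsto (fun m => φ.comp (T m)) Filter.atTop (nhds φ) := by
  rw [tendsto_iff_norm_sub_tendsto_zero]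
  have h := (hMd (φ.comp P)).mul_const ‖j‖
  rw [zero_mul] at h
  refine squeeze_zero (fun _ => norm_nonneg _) (fun m => ?_) h
  have h1 : φ.comp (T m) - φ = -(((φ.comp P).comp (M m)).comp j) := by
    ext1 g
    simp [hT]
  rw [h1, norm_neg]
  exact ContinuousLinearMap.opNorm_comp_le _ _

end Approximation

section IntegralRepresentation

variable [CompleteSpace E] {V : Type*} [NormedAddCommGroup V] [NormedSpace ℝ V]
  [FiniteDimensional ℝ V] [MeasurableSpace V] [BorelSpace V] {μ : Measure V}
  [IsFiniteMeasureOnCompacts μ] {K : V → E} {δ : V → E →L[ℂ] ℂ}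

omit [NormedSpace ℝ V] [FiniteDimensional ℝ V] in
-- Compact support and norm continuity of `K` and `δ` make `∫ f(w) δ_w ⊗ K_w` a Bochner integral in
-- operator norm, so `Θ` may be taken inside. The evaluations identify this integral with `A`.
lemma apply_eq_integral_rankOne (hK : Continuous K) (hδ : Continuous δ)
    (hsep : ∀ g, (∀ b, δ b g = 0) → g = 0) {f : V → ℂ} (hfc : Continuous f)
    (hf : HasCompactSupport f) {A : E →L[ℂ] E}
    (hA : ∀ b g, δ b (A g) = ∫ w, δ b (K w) * (f w * δ w g) ∂μ) (Θ : (E →L[ℂ] E) →L[ℂ] ℂ) :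
    Θ A = ∫ w, f w * Θ ((δ w).smulRight (K w)) ∂μ := by
  have hi : Integrable (fun w => f w • (δ w).smulRight (K w)) μ :=
    (hfc.smul (continuous_smulRight hδ hK)).integrable_of_hasCompactSupport hf.smul_right
  have h : A = ∫ w, f w • (δ w).smulRight (K w) ∂μ := by
    ext1 g
    refine sub_eq_zero.1 (hsep _ fun b => ?_)
    have h1 := ((δ b).comp (ContinuousLinearMap.apply ℂ E g)).integral_comp_comm hi
    rw [map_sub, sub_eq_zero, hA]
    refine Eq.trans (integral_congr_ae (Filter.Eventually.of_forall fun w => ?_)) h1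
    simp only [ContinuousLinearMap.comp_apply, ContinuousLinearMap.apply_apply,
      ContinuousLinearMap.smulRight_apply, map_smul, smul_eq_mul]
    ring
  rw [h, ← Θ.integral_comp_comm hi]
  simp only [map_smul, smul_eq_mul]

omit [CompleteSpace E] in
-- The fundamental lemma of the calculus of variations gives vanishing almost everywhere; continuity
-- and full support of `μ` upgrade it to every point.
lemma apply_rankOne_eq_zero [μ.IsOpenPosMeasure] (hK : Continuous K) (hδ : Continuous δ)
    (Θ : (E →L[ℂ] E) →L[ℂ] ℂ)
    (h : ∀ f : V → ℂ, Continuous f → HasCompactSupport f →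
      ∫ w, f w * Θ ((δ w).smulRight (K w)) ∂μ = 0) (w : V) :
    Θ ((δ w).smulRight (K w)) = 0 := by
  have hc : Continuous fun w => Θ ((δ w).smulRight (K w)) :=
    Θ.continuous.comp (continuous_smulRight hδ hK)
  have hae : ∀ᵐ w ∂μ, Θ ((δ w).smulRight (K w)) = 0 := by
    refine ae_eq_zero_of_integral_contDiff_smul_eq_zero hc.locallyIntegrable fun g hg hgs => ?_
    simpa only [Complex.real_smul] using h (fun w => (g w : ℂ))
      (Complex.continuous_ofReal.comp hg.continuous) (hgs.comp_left Complex.ofReal_zero)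
  exact congrFun (hc.ae_eq_iff_eq μ continuous_const |>.1 hae) w

/-- A closed space of operators on a reproducing kernel Banach space which contains the Toeplitz
operators with compactly supported symbols contains the compact operators. -/
theorem compact_mem_of_toeplitz_mem [μ.IsOpenPosMeasure] {L : Type*} [NormedAddCommGroup L]
    [NormedSpace ℂ L] {P : L →L[ℂ] E} {j : E →L[ℂ] L} {M : ℕ → L →L[ℂ] L}
    (hK : Continuous K) (hδ : Continuous δ) (hsep : ∀ g, (∀ b, δ b g = 0) → g = 0)
    (hpol : ∀ B : E →L[ℂ] (E →L[ℂ] ℂ) →L[ℂ] ℂ, (∀ w, B (K w) (δ w) = 0) → ∀ a b, B (K a) (δ b) = 0)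
    {A : (V →ᵇ ℂ) → E →L[ℂ] E} (hA : ∀ f : V →ᵇ ℂ, HasCompactSupport f →
      ∀ b g, δ b (A f g) = ∫ w, δ b (K w) * (f w * δ w g) ∂μ)
    {χ : ℕ → V →ᵇ ℂ} (hχ : ∀ m, HasCompactSupport (χ m))
    (hT : ∀ m g, A (χ m) g = g - P (M m (j g))) (hM1 : ∀ m, ‖M m‖ ≤ 1)
    (hM0 : ∀ u, Filter.Tendsto (fun m => M m u) Filter.atTop (nhds 0))
    (hMd : ∀ Λ : L →L[ℂ] ℂ, Filter.Tendsto (fun m => ‖Λ.comp (M m)‖) Filter.atTop (nhds 0))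
    {S : Submodule ℂ (E →L[ℂ] E)} (hS : IsClosed (S : Set (E →L[ℂ] E)))
    (h : ∀ f : V →ᵇ ℂ, HasCompactSupport f → A f ∈ S) {Q : E →L[ℂ] E} (hQ : IsCompactOperator Q) :
    Q ∈ S := by
  refine mem_of_forall_functional hS fun Φ hΦ => ?_
  refine apply_compact_eq_zero K δ (fun m => A (χ m)) (fun Θ hΘ m => ?_)
    (fun Q hQ => tendsto_comp_compact_of_tail hT hM1 hM0 hQ)
    (tendsto_functional_comp_of_tail hT hMd) Φ ?_ Q hQ
  · rw [apply_eq_integral_rankOne hK hδ hsep (χ m).continuous (hχ m) (hA (χ m) (hχ m)) Θ]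
    simp only [hΘ, mul_zero, integral_zero]
  · refine fun a b => hpol (rankOneForm Φ) (fun w => ?_) a b
    refine apply_rankOne_eq_zero (μ := μ) hK hδ Φ (fun f hfc hf => ?_) w
    obtain ⟨C, hC⟩ := hf.exists_bound_of_continuous hfc
    set f' : V →ᵇ ℂ := BoundedContinuousFunction.ofNormedAddCommGroup f hfc C hC
    have h1 := hΦ _ (h f' hf)
    rwa [apply_eq_integral_rankOne hK hδ hsep f'.continuous hf (hA f' hf) Φ] at h1

omit [NormedSpace ℝ V] [FiniteDimensional ℝ V] in
/-- An operator which vanishes on the kernel functions is zero. -/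
theorem eq_zero_of_apply_kernel_eq_zero {L : Type*} [NormedAddCommGroup L]
    [NormedSpace ℂ L] {P : L →L[ℂ] E} {j : E →L[ℂ] L} {M : ℕ → L →L[ℂ] L}
    (hK : Continuous K) (hδ : Continuous δ) (hsep : ∀ g, (∀ b, δ b g = 0) → g = 0)
    {A : (V →ᵇ ℂ) → E →L[ℂ] E} (hA : ∀ f : V →ᵇ ℂ, HasCompactSupport f →
      ∀ b g, δ b (A f g) = ∫ w, δ b (K w) * (f w * δ w g) ∂μ)
    {χ : ℕ → V →ᵇ ℂ} (hχ : ∀ m, HasCompactSupport (χ m))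
    (hT : ∀ m g, A (χ m) g = g - P (M m (j g)))
    (hM0 : ∀ u, Filter.Tendsto (fun m => M m u) Filter.atTop (nhds 0))
    {Q : E →L[ℂ] E} (hQ : ∀ a, Q (K a) = 0) : Q = 0 := by
  ext1 g
  -- The integral formula for the functional `R ↦ δ_b (Q (R g))`: its integrand contains `Q (K w) =
  -- 0`.
  have hz : ∀ m, Q (A (χ m) g) = 0 := by
    refine fun m => hsep _ fun b => ?_
    have h1 := apply_eq_integral_rankOne hK hδ hsep (χ m).continuous (hχ m) (hA (χ m) (hχ m))
      ((δ b).comp (Q.comp (ContinuousLinearMap.apply ℂ E g)))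
    simpa [hQ] using h1
  have hlim := (Q.continuous.tendsto g).comp (tendsto_apply_of_tail hT hM0 g)
  simp only [Function.comp_def, hz] at hlim
  exact (tendsto_nhds_unique hlim tendsto_const_nhds)

end IntegralRepresentation

end RankOne

/-! ### Cut-off functions -/

section Cutoff

variable {V : Type*} [NormedAddCommGroup V]

/-- The function `min 1 (max 0 (‖z‖ - m))`, which is `0` for `‖z‖ ≤ m` and `1` for
`‖z‖ ≥ m + 1`. -/
def tailFun (m : ℕ) (z : V) : ℝ := min 1 (max 0 (‖z‖ - m))

lemma tailFun_nonneg (m : ℕ) (z : V) : 0 ≤ tailFun m z := le_min zero_le_one (le_max_left _ _)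

lemma tailFun_le_one (m : ℕ) (z : V) : tailFun m z ≤ 1 := min_le_left _ _

lemma tailFun_of_le {m : ℕ} {z : V} (h : ‖z‖ ≤ m) : tailFun m z = 0 := by
  rw [tailFun, max_eq_left (by linarith), min_eq_right zero_le_one]

lemma tailFun_of_ge {m : ℕ} {z : V} (h : (m : ℝ) + 1 ≤ ‖z‖) : tailFun m z = 1 := by
  rw [tailFun, max_eq_right (by linarith), min_eq_left (by linarith)]

/-- `tailFun` as a bounded continuous function. -/
def tailBCF (V : Type*) [NormedAddCommGroup V] (m : ℕ) : V →ᵇ ℂ :=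
  BoundedContinuousFunction.ofNormedAddCommGroup (fun z => (tailFun m z : ℂ))
    (Complex.continuous_ofReal.comp (by unfold tailFun; fun_prop)) 1 fun z => by
      rw [Complex.norm_real, Real.norm_of_nonneg (tailFun_nonneg m z)]
      exact tailFun_le_one m z

lemma tailBCF_apply (m : ℕ) (z : V) : tailBCF V m z = (tailFun m z : ℂ) := rfl

lemma norm_tailBCF_le (m : ℕ) : ‖tailBCF V m‖ ≤ 1 :=
  BoundedContinuousFunction.norm_ofNormedAddCommGroup_le _ zero_le_one _

lemma norm_one_sub_tailBCF_le (m : ℕ) : ‖1 - tailBCF V m‖ ≤ 1 := by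
  refine (BoundedContinuousFunction.norm_le zero_le_one).2 fun z => ?_
  have h : (1 - tailBCF V m) z = ((1 - tailFun m z : ℝ) : ℂ) := by
    simp [tailBCF_apply]
  rw [h, Complex.norm_real, Real.norm_of_nonneg (by linarith [tailFun_le_one m z])]
  linarith [tailFun_nonneg m z]

lemma tendsto_tailBCF (z : V) :
    Filter.Tendsto (fun m => tailBCF V m z) Filter.atTop (nhds 0) := by
  refine tendsto_const_nhds.congr' ?_
  filter_upwards [Filter.eventually_ge_atTop ⌈‖z‖⌉₊] with m hm
  rw [tailBCF_apply, tailFun_of_le (Nat.ceil_le.1 hm), Complex.ofReal_zero]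

/-- The ramp of `tailBCF V m` ends at radius `m + 1 ≤ j`, where that of `tailBCF V j` has not yet
begun. -/
lemma tailBCF_mul (m j : ℕ) (h : m < j) : tailBCF V m * tailBCF V j = tailBCF V j := by
  ext z
  rw [BoundedContinuousFunction.mul_apply, tailBCF_apply, tailBCF_apply]
  rcases le_total ‖z‖ j with hz | hz
  · rw [tailFun_of_le hz]; simp
  · have : (m : ℝ) + 1 ≤ j := by exact_mod_cast h
    rw [tailFun_of_ge (this.trans hz)]; simp

lemma hasCompactSupport_one_sub_tailBCF [ProperSpace V] (m : ℕ) :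
    HasCompactSupport (1 - tailBCF V m : V →ᵇ ℂ) := by
  refine HasCompactSupport.intro (isCompact_closedBall (0 : V) (m + 1)) fun z hz => ?_
  rw [mem_closedBall_zero_iff, not_le] at hz
  simp [tailBCF_apply, tailFun_of_ge hz.le]

end Cutoff

/-! ### Toeplitz operators -/

section Toeplitz

variable {n : ℕ} {p t : ℝ} [hpf : Fact (1 < p)] [htf : Fact (0 < t)]

/-- The Toeplitz operator with symbol `f`. -/
def toeplitzOp (n : ℕ) (p t : ℝ) [hpf : Fact (1 < p)] [htf : Fact (0 < t)]
    (f : (Fin n → ℂ) →ᵇ ℂ) : fockSpace n p t →L[ℂ] fockSpace n p t :=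
  (fockProj n p t).comp ((mulLp (gaussianMeasure n (2 * t / p)) (ENNReal.ofReal p) f).comp
    (fockSpace n p t).subtypeL)

lemma toeplitzOp_apply (f : (Fin n → ℂ) →ᵇ ℂ) (g : fockSpace n p t) :
    toeplitzOp n p t f g
      = fockProj n p t (mulLp (gaussianMeasure n (2 * t / p)) (ENNReal.ofReal p) f g) := rfl

lemma isToeplitzOperator_toeplitzOp (f : (Fin n → ℂ) →ᵇ ℂ) :
    IsToeplitzOperator n p t f (toeplitzOp n p t f) := by
  intro g
  rw [toeplitzOp_apply]
  refine (coeFn_fockProj _).trans (Filter.EventuallyEq.of_eq ?_)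
  exact fockProjection_congr htf.out fock_param_pos (coeFn_mulLp f _)

/-- The defining relation determines the operator, so the generators of `toeplitzLin` are exactly
the operators `toeplitzOp`. -/
lemma IsToeplitzOperator.eq_toeplitzOp {f : (Fin n → ℂ) →ᵇ ℂ}
    {A : fockSpace n p t →L[ℂ] fockSpace n p t} (hA : IsToeplitzOperator n p t f A) :
    A = toeplitzOp n p t f := by
  ext1 g
  ext1
  exact Lp.ext ((hA g).trans (isToeplitzOperator_toeplitzOp f g).symm)

lemma fockEval_toeplitzOp (f : (Fin n → ℂ) →ᵇ ℂ) (g : fockSpace n p t) (b : Fin n → ℂ) :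
    fockEval n p t b (toeplitzOp n p t f g)
      = ∫ w, Complex.exp (hermProd b w / (t : ℂ)) * (f w * fockEval n p t w g)
        ∂(gaussianMeasure n t) := by
  rw [toeplitzOp_apply, fockEval_fockProj, evalLp_apply]
  have h : (mulLp (gaussianMeasure n (2 * t / p)) (ENNReal.ofReal p) f g : (Fin n → ℂ) → ℂ)
      =ᵐ[gaussianMeasure n (2 * t / p)] fun w => f w * fockEval n p t w g := by
    filter_upwards [coeFn_mulLp f (g : FockLp n p t), coeFn_fockSpace g] with w h1 h2
    rw [h1, h2]; rfl
  rw [fockProjection_congr htf.out fock_param_pos h]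
  rfl

lemma fockEval_toeplitzOp' (f : (Fin n → ℂ) →ᵇ ℂ) (b : Fin n → ℂ) (g : fockSpace n p t) :
    fockEval n p t b (toeplitzOp n p t f g)
      = ∫ w, fockEval n p t b (coherent n p t w) * (f w * fockEval n p t w g)
        ∂(gaussianMeasure n t) := by
  simp only [fockEval_toeplitzOp, fockEval_coherent]

lemma toeplitzOp_one_sub (f : (Fin n → ℂ) →ᵇ ℂ) (g : fockSpace n p t) :
    toeplitzOp n p t (1 - f) g = g - fockProj n p t
      (mulLp (gaussianMeasure n (2 * t / p)) (ENNReal.ofReal p) f ((fockSpace n p t).subtypeL g)) := by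
  rw [toeplitzOp_apply, mulLp_one_sub, map_sub, fockProj_coe]
  rfl

/-- A closed space of operators which contains the Toeplitz operators with compactly supported
symbols contains the compact operators. -/
lemma compact_mem_of_toeplitzOp_mem
    {S : Submodule ℂ (fockSpace n p t →L[ℂ] fockSpace n p t)}
    (hS : IsClosed (S : Set (fockSpace n p t →L[ℂ] fockSpace n p t)))
    (h : ∀ f : (Fin n → ℂ) →ᵇ ℂ, HasCompactSupport f → toeplitzOp n p t f ∈ S)
    {Q : fockSpace n p t →L[ℂ] fockSpace n p t} (hQ : IsCompactOperator Q) : Q ∈ S := by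
  have := isProbabilityMeasure_gaussianMeasure (n := n) htf.out
  have := (absolutelyContinuous_gaussianMeasure (n := n) htf.out).isOpenPosMeasure
  have hP : 1 < ENNReal.ofReal p := by
    rw [← ENNReal.ofReal_one]
    exact (ENNReal.ofReal_lt_ofReal_iff (zero_lt_one.trans hpf.out)).2 hpf.out
  exact compact_mem_of_toeplitz_mem (E := fockSpace n p t) (L := FockLp n p t)
    (μ := gaussianMeasure n t) (K := coherent n p t) (δ := fockEval n p t)
    (P := fockProj n p t) (j := (fockSpace n p t).subtypeL)
    (M := fun m => mulLp _ _ (tailBCF (Fin n → ℂ) m)) (A := toeplitzOp n p t)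
    (χ := fun m => 1 - tailBCF (Fin n → ℂ) m)
    continuous_coherent continuous_fockEval
    (fun g hg => fockSpace_ext fun b => by rw [hg b, map_zero]) polarization
    (fun f _ => fockEval_toeplitzOp' f) hasCompactSupport_one_sub_tailBCF
    (fun m => toeplitzOp_one_sub _) (fun m => (norm_mulLp_le _).trans (norm_tailBCF_le m))
    (tendsto_mulLp_zero ENNReal.ofReal_ne_top norm_tailBCF_le tendsto_tailBCF)
    (tendsto_norm_comp_mulLp_zero hP ENNReal.ofReal_ne_top norm_tailBCF_le
      norm_one_sub_tailBCF_le tendsto_tailBCF tailBCF_mul) hS h hQ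

/-- Operators are determined by their values on coherent states. -/
lemma eq_zero_of_coherent_eq_zero {Q : fockSpace n p t →L[ℂ] fockSpace n p t}
    (hQ : ∀ a, Q (coherent n p t a) = 0) : Q = 0 := by
  have := isProbabilityMeasure_gaussianMeasure (n := n) htf.out
  exact eq_zero_of_apply_kernel_eq_zero (E := fockSpace n p t) (L := FockLp n p t)
    (μ := gaussianMeasure n t) (K := coherent n p t) (δ := fockEval n p t)
    (P := fockProj n p t) (j := (fockSpace n p t).subtypeL)
    (M := fun m => mulLp _ _ (tailBCF (Fin n → ℂ) m)) (A := toeplitzOp n p t)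
    (χ := fun m => 1 - tailBCF (Fin n → ℂ) m)
    continuous_coherent continuous_fockEval
    (fun g hg => fockSpace_ext fun b => by rw [hg b, map_zero])
    (fun f _ => fockEval_toeplitzOp' f) hasCompactSupport_one_sub_tailBCF
    (fun m => toeplitzOp_one_sub _)
    (tendsto_mulLp_zero ENNReal.ofReal_ne_top norm_tailBCF_le tendsto_tailBCF) hQ

end Toeplitz

/-! ### Translation-invariant algebras containing a function vanishing at infinity -/

section StoneWeierstrass

/-- The function `v ↦ F v - F ∞` on a space, for `F` on its one-point compactification. -/
def subInfty {V : Type*} [TopologicalSpace V] (F : C(OnePoint V, ℂ)) : V →ᵇ ℂ :=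
  (BoundedContinuousFunction.mkOfCompact F).compContinuous ⟨(↑), OnePoint.continuous_coe⟩
    - BoundedContinuousFunction.const V (F OnePoint.infty)

lemma subInfty_apply {V : Type*} [TopologicalSpace V] (F : C(OnePoint V, ℂ)) (v : V) :
    subInfty F v = F v - F OnePoint.infty := rfl

lemma continuous_subInfty {V : Type*} [TopologicalSpace V] :
    Continuous (subInfty : C(OnePoint V, ℂ) → V →ᵇ ℂ) := by
  refine (LipschitzWith.of_dist_le_mul (K := 2) fun F G => ?_).continuous
  refine (BoundedContinuousFunction.dist_le (by positivity)).2 fun v => ?_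
  rw [subInfty_apply, subInfty_apply]
  refine (dist_sub_sub_le _ _ _ _).trans ?_
  have h1 := ContinuousMap.dist_apply_le_dist (f := F) (g := G) (v : OnePoint V)
  have h2 := ContinuousMap.dist_apply_le_dist (f := F) (g := G) OnePoint.infty
  rw [NNReal.coe_ofNat]
  linarith

/-- The functions on the one-point compactification which lie in `D` up to a constant. -/
def onePointAlgebra {V : Type*} [TopologicalSpace V] (D : NonUnitalStarSubalgebra ℂ (V →ᵇ ℂ)) :
    StarSubalgebra ℂ C(OnePoint V, ℂ) where
  carrier := {F | subInfty F ∈ D}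
  mul_mem' {F G} hF hG := by
    -- Subtracting the value at infinity is not multiplicative, but the correction terms are scalar
    -- multiples of elements of `D`.
    have h : subInfty (F * G) = subInfty F * subInfty G + G OnePoint.infty • subInfty F
        + F OnePoint.infty • subInfty G := by
      ext v
      simp only [subInfty_apply, BoundedContinuousFunction.add_apply,
        BoundedContinuousFunction.mul_apply, BoundedContinuousFunction.smul_apply,
        ContinuousMap.mul_apply, smul_eq_mul]
      ring
    change subInfty (F * G) ∈ D
    rw [h]
    exact add_mem (add_mem (mul_mem hF hG) (SMulMemClass.smul_mem _ hF)) (SMulMemClass.smul_mem _ hG)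
  add_mem' {F G} hF hG := by
    have h : subInfty (F + G) = subInfty F + subInfty G := by
      ext v
      simp only [subInfty_apply, BoundedContinuousFunction.add_apply, ContinuousMap.add_apply]
      ring
    change subInfty (F + G) ∈ D
    rw [h]
    exact add_mem hF hG
  algebraMap_mem' c := by
    have h : subInfty (algebraMap ℂ C(OnePoint V, ℂ) c) = 0 := by
      ext v
      simp [subInfty_apply]
    change subInfty _ ∈ D
    rw [h]
    exact zero_mem D
  star_mem' {F} hF := by
    have h : subInfty (star F) = star (subInfty F) := by
      ext v
      simp [subInfty_apply]
    change subInfty (star F) ∈ D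
    rw [h]
    exact star_mem hF

lemma mem_onePointAlgebra {V : Type*} [TopologicalSpace V]
    {D : NonUnitalStarSubalgebra ℂ (V →ᵇ ℂ)} {F : C(OnePoint V, ℂ)} :
    F ∈ onePointAlgebra D ↔ subInfty F ∈ D := Iff.rfl

/-- The extension by zero to the one-point compactification. -/
def extendZero {V : Type*} [TopologicalSpace V] [T2Space V] (f : V →ᵇ ℂ)
    (hf : Filter.Tendsto f (Filter.cocompact V) (nhds 0)) : C(OnePoint V, ℂ) :=
  OnePoint.continuousMapMk f.toContinuousMap 0 (by rwa [Filter.coclosedCompact_eq_cocompact])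

lemma extendZero_coe {V : Type*} [TopologicalSpace V] [T2Space V] (f : V →ᵇ ℂ)
    (hf : Filter.Tendsto f (Filter.cocompact V) (nhds 0)) (v : V) : extendZero f hf v = f v := rfl

lemma extendZero_infty {V : Type*} [TopologicalSpace V] [T2Space V] (f : V →ᵇ ℂ)
    (hf : Filter.Tendsto f (Filter.cocompact V) (nhds 0)) :
    extendZero f hf OnePoint.infty = 0 := rfl

lemma subInfty_extendZero {V : Type*} [TopologicalSpace V] [T2Space V] (f : V →ᵇ ℂ)
    (hf : Filter.Tendsto f (Filter.cocompact V) (nhds 0)) : subInfty (extendZero f hf) = f := by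
  ext v
  rw [subInfty_apply, extendZero_coe, extendZero_infty, sub_zero]

variable {n : ℕ}

lemma translateBy_apply (z : Fin n → ℂ) (f : (Fin n → ℂ) →ᵇ ℂ) (w : Fin n → ℂ) :
    translateBy z f w = f (w - z) := rfl

lemma tendsto_translateBy {f : (Fin n → ℂ) →ᵇ ℂ}
    (hf : Filter.Tendsto f (Filter.cocompact _) (nhds 0)) (z : Fin n → ℂ) :
    Filter.Tendsto (translateBy z f) (Filter.cocompact _) (nhds 0) :=
  hf.comp (Homeomorph.subRight z).isClosedEmbedding.tendsto_cocompact

/-- A function vanishing at infinity which has a period is zero. -/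
lemma eq_zero_of_periodic {V : Type*} [NormedAddCommGroup V] [NormedSpace ℝ V] [ProperSpace V]
    {f : V → ℂ} (hf : Filter.Tendsto f (Filter.cocompact V) (nhds 0)) {d : V} (hd : d ≠ 0)
    (hper : ∀ u, f (u + d) = f u) (u : V) : f u = 0 := by
  -- The points `u + k d` leave every compact set while `f` keeps the value `f u` along them.
  have h1 : ∀ k : ℕ, f (u + (k : ℝ) • d) = f u := by
    intro k
    induction k with
    | zero => simp
    | succ k ih => rw [Nat.cast_succ, add_smul, one_smul, ← add_assoc, hper, ih]
  have h2 : Filter.Tendsto (fun k : ℕ => u + (k : ℝ) • d) Filter.atTop (Filter.cocompact V) := by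
    rw [← Metric.cobounded_eq_cocompact, ← tendsto_norm_atTop_iff_cobounded]
    have h3 : Filter.Tendsto (fun k : ℕ => (k : ℝ) * ‖d‖ - ‖u‖) Filter.atTop Filter.atTop :=
      Filter.tendsto_atTop_add_const_right _ _
        (tendsto_natCast_atTop_atTop.atTop_mul_const (norm_pos_iff.2 hd))
    refine Filter.tendsto_atTop_mono (fun k => ?_) h3
    have h4 := norm_sub_norm_le ((k : ℝ) • d) (-u)
    rw [norm_smul, norm_neg, Real.norm_natCast, sub_neg_eq_add, add_comm _ u] at h4
    exact h4
  have h3 := hf.comp h2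
  simp only [Function.comp_def, h1] at h3
  exact tendsto_nhds_unique tendsto_const_nhds h3

/-- A closed translation-invariant self-adjoint algebra of bounded functions which contains a
nonzero function vanishing at infinity contains all continuous functions with compact support. -/
theorem mem_of_hasCompactSupport {D : NonUnitalStarSubalgebra ℂ ((Fin n → ℂ) →ᵇ ℂ)}
    (hD : IsClosed (D : Set ((Fin n → ℂ) →ᵇ ℂ)))
    (hinv : ∀ z : Fin n → ℂ, ∀ f ∈ D, translateBy z f ∈ D) {f₀ : (Fin n → ℂ) →ᵇ ℂ} (hf₀ : f₀ ∈ D)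
    (hne : f₀ ≠ 0) (h0 : Filter.Tendsto f₀ (Filter.cocompact _) (nhds 0))
    {f : (Fin n → ℂ) →ᵇ ℂ} (hf : HasCompactSupport f) : f ∈ D := by
  obtain ⟨u, hu⟩ : ∃ u, f₀ u ≠ 0 := by
    by_contra! h
    exact hne (BoundedContinuousFunction.ext h)
  have hmem : ∀ z, extendZero (translateBy z f₀) (tendsto_translateBy h0 z)
      ∈ onePointAlgebra D := fun z => by
    rw [mem_onePointAlgebra, subInfty_extendZero]
    exact hinv z f₀ hf₀
  have hval : ∀ v : Fin n → ℂ, f₀ (v - (v - u)) ≠ 0 := fun v => by rwa [sub_sub_cancel]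
  -- The translate by `v - u` takes at `v` the nonzero value `f₀ u`, which separates `v` from
  -- infinity.
  have hsep : (onePointAlgebra D).SeparatesPoints := by
    intro x y hxy
    induction x using OnePoint.rec with
    | infty =>
      induction y using OnePoint.rec with
      | infty => exact absurd rfl hxy
      | coe v => exact ⟨_, ⟨_, hmem (v - u), rfl⟩, (hval v).symm⟩
    | coe v =>
      induction y using OnePoint.rec with
      | infty => exact ⟨_, ⟨_, hmem (v - u), rfl⟩, hval v⟩
      | coe v' =>
        by_contra hcon
        -- If no translate of `f₀` separates `v` from `v'`, then `v' - v` is a period of `f₀`.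
        have hall : ∀ z, f₀ (v - z) = f₀ (v' - z) := fun z => by
          by_contra hz
          exact hcon ⟨_, ⟨_, hmem z, rfl⟩, hz⟩
        have hd : v' - v ≠ 0 := sub_ne_zero.2 fun h => hxy (by rw [h])
        refine hu (eq_zero_of_periodic h0 hd (fun w => ?_) u)
        have := hall (v - w)
        rw [sub_sub_cancel] at this
        rw [this]
        congr 1
        abel
  have htop := ContinuousMap.starSubalgebra_topologicalClosure_eq_top_of_separatesPoints _ hsep
  have hcl : IsClosed (onePointAlgebra D : Set C(OnePoint (Fin n → ℂ), ℂ)) :=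
    hD.preimage continuous_subInfty
  have hf0 : Filter.Tendsto f (Filter.cocompact _) (nhds 0) := hf.is_zero_at_infty
  have hin : extendZero f hf0 ∈ (onePointAlgebra D).topologicalClosure := by
    rw [htop]; trivial
  have hin' : extendZero f hf0 ∈ onePointAlgebra D :=
    (StarSubalgebra.topologicalClosure_minimal le_rfl hcl) hin
  rwa [mem_onePointAlgebra, subInfty_extendZero] at hin'

end StoneWeierstrass

/-! ### The Berezin transform -/

section Berezin

/-! ### Transforms built from bounded families of vectors and functionals -/

section Abstract

variable {V E : Type*} [TopologicalSpace V] [NormedAddCommGroup E] [NormedSpace ℂ E]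

/-- The map `A ↦ (w ↦ δ_w (A K_w))` for bounded families `K` and `δ`. -/
def berezinMap (K : V → E) (δ : V → E →L[ℂ] ℂ) (hK : Continuous K) (hδ : Continuous δ) {C₁ C₂ : ℝ}
    (hC₁ : 0 ≤ C₁) (hK₁ : ∀ w, ‖K w‖ ≤ C₁) (hC₂ : 0 ≤ C₂) (hδ₂ : ∀ w, ‖δ w‖ ≤ C₂) :
    (E →L[ℂ] E) →L[ℂ] (V →ᵇ ℂ) :=
  have hle : ∀ (A : E →L[ℂ] E) (w : V), ‖δ w (A (K w))‖ ≤ C₂ * C₁ * ‖A‖ := fun A w =>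
    calc ‖δ w (A (K w))‖ ≤ C₂ * ‖A (K w)‖ := (δ w).le_of_opNorm_le (hδ₂ w) _
      _ ≤ C₂ * (‖A‖ * C₁) := by gcongr; exact A.le_opNorm_of_le (hK₁ w)
      _ = C₂ * C₁ * ‖A‖ := by ring
  LinearMap.mkContinuous
    { toFun := fun A => BoundedContinuousFunction.ofNormedAddCommGroup (fun w => δ w (A (K w)))
        (hδ.clm_apply (A.continuous.comp hK)) _ (hle A)
      map_add' := fun A B => by ext w; simp
      map_smul' := fun c A => by ext w; simp } (C₂ * C₁) fun A =>
    BoundedContinuousFunction.norm_ofNormedAddCommGroup_le _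
      (mul_nonneg (mul_nonneg hC₂ hC₁) (norm_nonneg _)) (hle A)

/-- Compactness of `A` upgrades pointwise convergence `δ w → 0` to `‖δ w ∘ A‖ → 0`, and the vectors
`K w` are bounded. -/
lemma tendsto_apply_compact {ι : Type*} {K : ι → E} {δ : ι → E →L[ℂ] ℂ} {C₁ C₂ : ℝ}
    (hK₁ : ∀ w, ‖K w‖ ≤ C₁) (hδ₂ : ∀ w, ‖δ w‖ ≤ C₂) {l : Filter ι}
    (h0 : ∀ g, Filter.Tendsto (fun w => δ w g) l (nhds 0)) {A : E →L[ℂ] E}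
    (hA : IsCompactOperator A) : Filter.Tendsto (fun w => δ w (A (K w))) l (nhds 0) := by
  have h := (tendsto_norm_comp_compact hδ₂ h0 hA).mul_const C₁
  rw [zero_mul] at h
  refine squeeze_zero_norm (fun w => ?_) h
  exact ((δ w).comp A).le_opNorm_of_le (hK₁ w)

/-- The vectors on which a family of functionals tends to zero. -/
def vanishingSubmodule {ι : Type*} (δ : ι → E →L[ℂ] ℂ) (l : Filter ι) : Submodule ℂ E where
  carrier := {g | Filter.Tendsto (fun w => δ w g) l (nhds 0)}
  zero_mem' := by simpa using tendsto_const_nhds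
  add_mem' {g g'} hg hg' := by
    have := Filter.Tendsto.add hg hg'
    simpa using this
  smul_mem' c g hg := by
    have := Filter.Tendsto.const_mul c hg
    simpa using this

lemma isClosed_vanishingSubmodule {ι : Type*} {δ : ι → E →L[ℂ] ℂ} {C : ℝ} (hC : 0 ≤ C)
    (hδ : ∀ w, ‖δ w‖ ≤ C) (l : Filter ι) : IsClosed (vanishingSubmodule δ l : Set E) := by
  refine isClosed_of_closure_subset fun g hg => ?_
  change Filter.Tendsto (fun w => δ w g) l (nhds 0)
  rw [Metric.tendsto_nhds]
  intro ε hε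
  obtain ⟨g', hg', hd⟩ := Metric.mem_closure_iff.1 hg (ε / (2 * (C + 1))) (by positivity)
  have h1 : ∀ᶠ w in l, dist (δ w g') 0 < ε / 2 := (Metric.tendsto_nhds.1 hg') _ (by positivity)
  filter_upwards [h1] with w hw
  rw [dist_zero_right] at hw ⊢
  have h2 : δ w g = δ w (g - g') + δ w g' := by rw [← map_add, sub_add_cancel]
  have h3 : ‖δ w (g - g')‖ ≤ C * (ε / (2 * (C + 1))) := by
    refine ((δ w).le_of_opNorm_le (hδ w) _).trans (mul_le_mul_of_nonneg_left ?_ hC)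
    rw [← dist_eq_norm]
    exact hd.le
  have h4 : C * (ε / (2 * (C + 1))) ≤ ε / 2 := by
    rw [mul_div_assoc', div_le_div_iff₀ (by positivity) (by positivity)]
    nlinarith
  rw [h2]
  exact (norm_add_le _ _).trans_lt (by linarith)

/-- The bilinear form `(g, φ) ↦ φ (A g)`. -/
def operatorForm (A : E →L[ℂ] E) : E →L[ℂ] (E →L[ℂ] ℂ) →L[ℂ] ℂ :=
  (ContinuousLinearMap.apply ℂ ℂ).comp A

end Abstract

variable {n : ℕ} {p t : ℝ} [hpf : Fact (1 < p)] [htf : Fact (0 < t)]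

lemma norm_sq_le_euclSq (w : Fin n → ℂ) : ‖w‖ ^ 2 ≤ euclSq w := by
  have h : ‖w‖ ≤ Real.sqrt (euclSq w) := by
    refine (pi_norm_le_iff_of_nonneg (Real.sqrt_nonneg _)).2 fun i => Real.le_sqrt_of_sq_le ?_
    exact Finset.single_le_sum (f := fun i => ‖w i‖ ^ 2) (fun _ _ => by positivity)
      (Finset.mem_univ i)
  calc ‖w‖ ^ 2 ≤ Real.sqrt (euclSq w) ^ 2 := by gcongr
    _ = euclSq w := Real.sq_sqrt (euclSq_nonneg w)

omit htf in
lemma tendsto_fockWeight (ht : 0 < t) :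
    Filter.Tendsto (fockWeight t : (Fin n → ℂ) → ℝ) (Filter.cocompact _) (nhds 0) := by
  have h1 : Filter.Tendsto (fun w : Fin n → ℂ => euclSq w / (2 * t)) (Filter.cocompact _)
      Filter.atTop := by
    refine Filter.Tendsto.atTop_div_const (by positivity) ?_
    refine Filter.tendsto_atTop_mono norm_sq_le_euclSq ?_
    exact (Filter.tendsto_pow_atTop two_ne_zero).comp tendsto_norm_cocompact_atTop
  have h2 := Real.tendsto_exp_neg_atTop_nhds_zero.comp h1
  refine h2.congr fun w => ?_
  simp [fockWeight, neg_div]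

/-- The normalised coherent state. -/
def normCoherent (n : ℕ) (p t : ℝ) [hpf : Fact (1 < p)] [htf : Fact (0 < t)] (w : Fin n → ℂ) :
    fockSpace n p t := (fockWeight t w : ℂ) • coherent n p t w

/-- The normalised point evaluation. -/
def normEval (n : ℕ) (p t : ℝ) [hpf : Fact (1 < p)] [htf : Fact (0 < t)] (w : Fin n → ℂ) :
    fockSpace n p t →L[ℂ] ℂ := (fockWeight t w : ℂ) • fockEval n p t w

lemma continuous_normCoherent : Continuous (normCoherent n p t) :=
  (Complex.continuous_ofReal.comp (continuous_fockWeight t)).smul continuous_coherent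

lemma continuous_normEval : Continuous (normEval n p t) :=
  (Complex.continuous_ofReal.comp (continuous_fockWeight t)).smul continuous_fockEval

lemma exists_norm_normCoherent_le (n : ℕ) (p t : ℝ) [hpf : Fact (1 < p)] [htf : Fact (0 < t)] :
    ∃ C : ℝ, 0 ≤ C ∧ ∀ w, ‖normCoherent n p t w‖ ≤ C := by
  obtain ⟨C, hC, h⟩ := exists_norm_coherent_le n p t
  refine ⟨C, hC, fun w => ?_⟩
  rw [normCoherent, norm_smul, Complex.norm_real, Real.norm_of_nonneg (fockWeight_pos t w).le,
    mul_comm]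
  exact h w

lemma exists_norm_normEval_le (n : ℕ) (p t : ℝ) [hpf : Fact (1 < p)] [htf : Fact (0 < t)] :
    ∃ C : ℝ, 0 ≤ C ∧ ∀ w, ‖normEval n p t w‖ ≤ C := by
  obtain ⟨C, hC, h⟩ := exists_norm_fockEval_le n p t
  refine ⟨C, hC, fun w => ?_⟩
  refine (ContinuousLinearMap.opNorm_smul_le _ _).trans ?_
  rw [Complex.norm_real, Real.norm_of_nonneg (fockWeight_pos t w).le, mul_comm]
  exact h w

lemma normEval_apply (w : Fin n → ℂ) (g : fockSpace n p t) :
    normEval n p t w g = (fockWeight t w : ℂ) * fockEval n p t w g := rfl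

/-- The normalised point evaluations tend weakly to zero at infinity. -/
lemma tendsto_normEval (g : fockSpace n p t) :
    Filter.Tendsto (fun w => normEval n p t w g) (Filter.cocompact _) (nhds 0) := by
  obtain ⟨C, hC, hle⟩ := exists_norm_normEval_le n p t
  suffices h : g ∈ vanishingSubmodule (E := fockSpace n p t) (normEval n p t)
      (Filter.cocompact _) from h
  -- The vectors with the claimed decay form a closed subspace, which contains each coherent state
  -- by an explicit Gaussian bound. It remains to see that a functional killing the coherent states
  -- kills `g`.
  refine mem_of_forall_functional (E := fockSpace n p t)
    (isClosed_vanishingSubmodule (E := fockSpace n p t) hC hle _) fun Φ hΦ => ?_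
  have hK : ∀ a, Φ (coherent n p t a) = 0 := by
    refine fun a => hΦ _ ?_
    change Filter.Tendsto (fun w => normEval n p t w (coherent n p t a)) _ _
    rw [tendsto_zero_iff_norm_tendsto_zero]
    have h1 : ∀ w, ‖normEval n p t w (coherent n p t a)‖
        = fockWeight t (w - a) * (fockWeight t a)⁻¹ := fun w => by
      rw [normEval_apply, fockEval_coherent, ← norm_exp_hermProd_mul_fockWeight, norm_mul,
        Complex.norm_real, Real.norm_of_nonneg (fockWeight_pos t w).le]
      have := (fockWeight_pos t a).ne'
      field_simp
    simp only [h1]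
    have h2 := ((tendsto_fockWeight (n := n) htf.out).comp
      (Homeomorph.subRight a).isClosedEmbedding.tendsto_cocompact).mul_const (fockWeight t a)⁻¹
    rw [zero_mul] at h2
    exact h2
  -- The rank-one operator `Φ(·) g` reduces the question to the fact that operators are determined
  -- on coherent states.
  have hz : Φ.smulRight g = 0 := eq_zero_of_coherent_eq_zero fun a => by
    change Φ (coherent n p t a) • g = 0
    rw [hK, zero_smul]
  have hg : Φ g • g = 0 := congrArg (fun A : fockSpace n p t →L[ℂ] fockSpace n p t => A g) hz
  rcases smul_eq_zero.1 hg with h | h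
  · exact h
  · rw [h, map_zero]

/-- The Berezin transform. -/
def berezin (n : ℕ) (p t : ℝ) [hpf : Fact (1 < p)] [htf : Fact (0 < t)] :
    (fockSpace n p t →L[ℂ] fockSpace n p t) →L[ℂ] ((Fin n → ℂ) →ᵇ ℂ) :=
  berezinMap (E := fockSpace n p t) (normCoherent n p t) (normEval n p t) continuous_normCoherent
    continuous_normEval (exists_norm_normCoherent_le n p t).choose_spec.1
    (exists_norm_normCoherent_le n p t).choose_spec.2
    (exists_norm_normEval_le n p t).choose_spec.1 (exists_norm_normEval_le n p t).choose_spec.2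

lemma berezin_apply (A : fockSpace n p t →L[ℂ] fockSpace n p t) (w : Fin n → ℂ) :
    berezin n p t A w = normEval n p t w (A (normCoherent n p t w)) := rfl

lemma berezin_apply' (A : fockSpace n p t →L[ℂ] fockSpace n p t) (w : Fin n → ℂ) :
    berezin n p t A w
      = (Real.exp (-euclSq w / t) : ℂ) * fockEval n p t w (A (coherent n p t w)) := by
  rw [berezin_apply, normEval_apply, normCoherent, map_smul, map_smul, smul_eq_mul, ← mul_assoc,
    ← Complex.ofReal_mul, fockWeight_mul_self]

/-- The Berezin transform of a compact operator vanishes at infinity. -/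
lemma tendsto_berezin {A : fockSpace n p t →L[ℂ] fockSpace n p t} (hA : IsCompactOperator A) :
    Filter.Tendsto (berezin n p t A) (Filter.cocompact _) (nhds 0) :=
  tendsto_apply_compact (E := fockSpace n p t) (exists_norm_normCoherent_le n p t).choose_spec.2
    (exists_norm_normEval_le n p t).choose_spec.2 tendsto_normEval hA

/-- The Berezin transform is injective. -/
lemma eq_zero_of_berezin_eq_zero {A : fockSpace n p t →L[ℂ] fockSpace n p t}
    (hA : berezin n p t A = 0) : A = 0 := by
  refine eq_zero_of_coherent_eq_zero fun a => fockSpace_ext fun b => ?_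
  rw [map_zero]
  -- The vanishing transform says that `(g, φ) ↦ φ (A g)` is zero on the diagonal pairs `(K_w,
  -- δ_w)`.
  refine polarization (operatorForm (E := fockSpace n p t) A)
    (fun w => ?_) a b
  have h := DFunLike.congr_fun hA w
  rw [berezin_apply'] at h
  exact (mul_eq_zero.1 h).resolve_left (Complex.ofReal_ne_zero.2 (Real.exp_pos _).ne')

/-- The squared modulus of the kernel, with both Gaussian weights, depends only on `w - v`; this is
why the Berezin transform acts on symbols by convolution. -/
lemma exp_kernel_mul (t : ℝ) (w v : Fin n → ℂ) :
    (Real.exp (-euclSq w / t) : ℂ) * ((Real.exp (-euclSq v / t) : ℂ)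
      * (Complex.exp (hermProd w v / (t : ℂ)) * Complex.exp (hermProd v w / (t : ℂ))))
      = (Real.exp (-euclSq (w - v) / t) : ℂ) := by
  simp only [Complex.ofReal_exp, ← Complex.exp_add]
  congr 1
  push_cast
  simp only [← hermProd_self, ← add_div]
  congr 1
  simp only [hermProd, ← Finset.sum_neg_distrib, ← Finset.sum_add_distrib, Pi.sub_apply, map_sub]
  exact Finset.sum_congr rfl fun i _ => by ring

/-- The Berezin transform of a Toeplitz operator is the Gaussian average of its symbol. -/
lemma berezin_toeplitzOp (f : (Fin n → ℂ) →ᵇ ℂ) (w : Fin n → ℂ) :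
    berezin n p t (toeplitzOp n p t f) w = ∫ v, translateBy v f w ∂(gaussianMeasure n t) := by
  rw [berezin_apply', fockEval_toeplitzOp, integral_gaussianMeasure htf.out,
    integral_gaussianMeasure htf.out, mul_left_comm, ← integral_const_mul]
  congr 1
  have h : ∀ v, (Real.exp (-euclSq w / t) : ℂ) * ((Real.exp (-euclSq v / t) : ℂ)
      * (Complex.exp (hermProd w v / (t : ℂ)) * (f v * fockEval n p t v (coherent n p t w))))
      = (Real.exp (-euclSq (w - v) / t) : ℂ) * f (w - (w - v)) := fun v => by
    rw [fockEval_coherent, sub_sub_cancel, ← exp_kernel_mul]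
    ring
  simp only [h, translateBy_apply]
  exact integral_sub_left_eq_self
    (fun v => (Real.exp (-euclSq v / t) : ℂ) * f (w - v)) volume w

/-- Uniform continuity is what makes the translation orbit continuous in the sup norm, so that it
can be integrated in the Bochner sense. -/
lemma continuous_translateBy {f : (Fin n → ℂ) →ᵇ ℂ} (hf : UniformContinuous f) :
    Continuous fun v => translateBy v f := by
  refine UniformContinuous.continuous (Metric.uniformContinuous_iff.2 fun ε hε => ?_)
  obtain ⟨δ, hδ, h⟩ := Metric.uniformContinuous_iff.1 hf (ε / 2) (by positivity)
  refine ⟨δ, hδ, fun {v v'} hv => ?_⟩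
  refine lt_of_le_of_lt ((BoundedContinuousFunction.dist_le (by positivity)).2 fun w => ?_)
    (half_lt_self hε)
  rw [translateBy_apply, translateBy_apply]
  refine (h ?_).le
  rwa [dist_sub_left]

lemma norm_translateBy_le (v : Fin n → ℂ) (f : (Fin n → ℂ) →ᵇ ℂ) : ‖translateBy v f‖ ≤ ‖f‖ :=
  (BoundedContinuousFunction.norm_le (norm_nonneg _)).2 fun w => f.norm_coe_le_norm (w - v)

/-- The pointwise Gaussian average is a Bochner integral of translates in the sup norm. Its
integrand takes values in the closed convex set `D` and the measure is a probability measure, so the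
integral stays in `D`. -/
lemma berezin_toeplitzOp_mem {D : NonUnitalStarSubalgebra ℂ ((Fin n → ℂ) →ᵇ ℂ)}
    (hD : IsClosed (D : Set ((Fin n → ℂ) →ᵇ ℂ))) (hu : ∀ f ∈ D, UniformContinuous f)
    (hinv : ∀ z : Fin n → ℂ, ∀ f ∈ D, translateBy z f ∈ D) {f : (Fin n → ℂ) →ᵇ ℂ} (hf : f ∈ D) :
    berezin n p t (toeplitzOp n p t f) ∈ D := by
  have := isProbabilityMeasure_gaussianMeasure (n := n) htf.out
  have hi : Integrable (fun v => translateBy v f) (gaussianMeasure n t) :=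
    Integrable.of_bound (continuous_translateBy (hu f hf)).aestronglyMeasurable ‖f‖
      (Filter.Eventually.of_forall fun v => norm_translateBy_le v f)
  have heq : berezin n p t (toeplitzOp n p t f)
      = ∫ v, translateBy v f ∂(gaussianMeasure n t) := by
    ext w
    rw [berezin_toeplitzOp]
    exact (BoundedContinuousFunction.evalCLM ℂ w).integral_comp_comm hi
  rw [heq]
  have hconv : Convex ℝ (D : Set ((Fin n → ℂ) →ᵇ ℂ)) := by
    intro x hx y hy a b _ _ _
    have h : a • x + b • y = (a : ℂ) • x + (b : ℂ) • y := by ext w; simp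
    rw [h]
    exact add_mem (SMulMemClass.smul_mem _ hx) (SMulMemClass.smul_mem _ hy)
  exact hconv.integral_mem hD (Filter.Eventually.of_forall fun v => hinv v f hf) hi

/-- The Berezin transform maps the Toeplitz space of `D` to `D`. -/
lemma berezin_mem_of_mem_toeplitzLin {D : NonUnitalStarSubalgebra ℂ ((Fin n → ℂ) →ᵇ ℂ)}
    (hD : IsClosed (D : Set ((Fin n → ℂ) →ᵇ ℂ))) (hu : ∀ f ∈ D, UniformContinuous f)
    (hinv : ∀ z : Fin n → ℂ, ∀ f ∈ D, translateBy z f ∈ D)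
    {A : fockSpace n p t →L[ℂ] fockSpace n p t}
    (hA : A ∈ toeplitzLin n p t (D : Set ((Fin n → ℂ) →ᵇ ℂ))) : berezin n p t A ∈ D := by
  have hle : toeplitzLin n p t (D : Set ((Fin n → ℂ) →ᵇ ℂ))
      ≤ D.toNonUnitalSubalgebra.toSubmodule.comap (berezin n p t).toLinearMap := by
    refine Submodule.topologicalClosure_minimal _ (Submodule.span_le.2 ?_)
      (hD.preimage (berezin n p t).continuous)
    rintro A ⟨f, hf, hA⟩
    rw [hA.eq_toeplitzOp]
    exact berezin_toeplitzOp_mem hD hu hinv hf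
  exact hle hA

omit htf in
lemma isClosed_toeplitzLin (S : Set ((Fin n → ℂ) →ᵇ ℂ)) :
    IsClosed (toeplitzLin n p t S : Set (fockSpace n p t →L[ℂ] fockSpace n p t)) :=
  isClosed_closure

lemma toeplitzOp_mem_toeplitzLin {S : Set ((Fin n → ℂ) →ᵇ ℂ)} {f : (Fin n → ℂ) →ᵇ ℂ} (hf : f ∈ S) :
    toeplitzOp n p t f ∈ toeplitzLin n p t S :=
  Submodule.le_topologicalClosure _
    (Submodule.subset_span ⟨f, hf, isToeplitzOperator_toeplitzOp f⟩)

end Berezin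

end

theorem mainTheorem10 (n : ℕ) (p t : ℝ) [Fact (1 < p)] (ht : 0 < t)
    (D₀ : NonUnitalStarSubalgebra ℂ ((Fin n → ℂ) →ᵇ ℂ))
    (hD₀_closed : IsClosed (D₀ : Set ((Fin n → ℂ) →ᵇ ℂ)))
    (hD₀_BUC : ∀ f ∈ D₀, UniformContinuous f)
    (hD₀_inv : ∀ z : Fin n → ℂ, ∀ f ∈ D₀, translateBy z f ∈ D₀)
    (hK : ∃ K ∈ toeplitzLin n p t (D₀ : Set ((Fin n → ℂ) →ᵇ ℂ)), K ≠ 0 ∧ IsCompactOperator K) :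
    ∀ K : fockSpace n p t →L[ℂ] fockSpace n p t,
      IsCompactOperator K → K ∈ toeplitzLin n p t (D₀ : Set ((Fin n → ℂ) →ᵇ ℂ)) := by
  have : Fact (0 < t) := ⟨ht⟩
  obtain ⟨K₀, hK₀, hne, hcomp⟩ := hK
  intro K hK
  refine compact_mem_of_toeplitzOp_mem (isClosed_toeplitzLin _)
    (fun f hf => toeplitzOp_mem_toeplitzLin ?_) hK
  -- The nonzero function of `D₀` vanishing at infinity is the Berezin transform of `K₀`.
  exact mem_of_hasCompactSupport hD₀_closed hD₀_inv
    (berezin_mem_of_mem_toeplitzLin hD₀_closed hD₀_BUC hD₀_inv hK₀)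
    (fun h => hne (eq_zero_of_berezin_eq_zero h)) (tendsto_berezin hcomp) hf
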